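/- For a graph $G$ and $U\subseteq V(G)$ let $N_G(U)$ be the set of vertices outside $U$ that have a neighbour in $U$; for an integer $t\ge 0$, $U$ is $t$-secluded if $|N_G(U)|\le t$, and an induced subgraph is $t$-secluded if its vertex set is. In the problem Secluded Clique the input consists of a finite simple graph $G$ on $n$ vertices, a weight function $\omega\colon V(G)\to\mathbb{Z}_{>0}$, a nonnegative integer $t$ and a positive integer $w$; the task is to decide whether $G$ contains a $t$-secluded clique $H$ with $\sum_{v\in V(H)}\omega(v)\ge w$. **Theorem.** Secluded Clique can be solved in time $2^{\mathcal{O}(t\log t)}\cdot n^{\mathcal{O}(1)}$. That is, there are a single random access machine program (unit-cost instructions: constants, addition, truncated subtraction, indirect loads and stores, jumps and comparisons) and constants $a,b,C$ such that on every input $(G,\omega,t,w)$ the program halts with the correct answer after at most $C\cdot 2^{a\,t\log_2 t}\cdot (n+1)^{b}$ steps, where $t\log_2 t$ is read as $0$ for $t=0$. -/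

import Mathlib

/-!
Random access machines.

The machine is the classical unit-cost RAM whose only arithmetic is addition and subtraction, so
that in every step the largest number present grows by at most one bit, and unit cost is
polynomially equivalent to logarithmic cost and to Turing machine time.
-/
namespace RAM

/-- Instructions. The arguments named `r`, `s`, `d` are register indices and `m` is a position in
the program. -/
inductive Instr : Type
  /-- `reg d := c` -/
  | const (d c : ℕ)
  /-- `reg d := reg r + reg s` -/
  | add (d r s : ℕ)
  /-- `reg d := reg r - reg s`, truncated at zero -/
  | sub (d r s : ℕ)
  /-- `reg d := mem (reg r)` -/
  | load (d r : ℕ)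
  /-- `mem (reg r) := reg s` -/
  | store (r s : ℕ)
  /-- `goto m` -/
  | jump (m : ℕ)
  /-- `if reg r < reg s then goto m` -/
  | jumpLt (r s m : ℕ)

/-- A program is a finite list of instructions. -/
abbrev Program : Type := List Instr

/-- A configuration: the program counter, the registers, and the memory. -/
structure Config : Type where
  pc : ℕ
  reg : ℕ → ℕ
  mem : ℕ → ℕ

/-- The effect of one instruction. -/
def exec (c : Config) : Instr → Config
  | .const d x => ⟨c.pc + 1, Function.update c.reg d x, c.mem⟩
  | .add d r s => ⟨c.pc + 1, Function.update c.reg d (c.reg r + c.reg s), c.mem⟩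
  | .sub d r s => ⟨c.pc + 1, Function.update c.reg d (c.reg r - c.reg s), c.mem⟩
  | .load d r => ⟨c.pc + 1, Function.update c.reg d (c.mem (c.reg r)), c.mem⟩
  | .store r s => ⟨c.pc + 1, c.reg, Function.update c.mem (c.reg r) (c.reg s)⟩
  | .jump m => ⟨m, c.reg, c.mem⟩
  | .jumpLt r s m => ⟨if c.reg r < c.reg s then m else c.pc + 1, c.reg, c.mem⟩

/-- The machine has halted when the program counter has left the program. -/
def Halted (P : Program) (c : Config) : Prop := P.length ≤ c.pc

/-- One step of computation, of cost one; halted configurations do not change. -/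
def step (P : Program) (c : Config) : Config :=
  match P[c.pc]? with
  | some i => exec c i
  | none => c

/-- Started in the configuration `c`, the program `P` halts after at most `T` steps, with the
correct answer to the question `A` in register `0`: `1` for yes and `0` for no. -/
def DecidesWithin (P : Program) (c : Config) (A : Prop) (T : ℝ) : Prop :=
  ∃ k : ℕ, (k : ℝ) ≤ T ∧ Halted P ((step P)^[k] c) ∧
    (A → ((step P)^[k] c).reg 0 = 1) ∧ (¬ A → ((step P)^[k] c).reg 0 = 0)

end RAM

/-- The open neighbourhood `N_G(U)` of a set `U` of vertices. -/
def SimpleGraph.openNeighborhood {V : Type*} (G : SimpleGraph V) (U : Set V) : Set V :=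
  {v | v ∉ U ∧ ∃ u ∈ U, G.Adj u v}

/-- A set `U` of vertices is `t`-secluded if `|N_G(U)| ≤ t`. -/
def SimpleGraph.IsSecluded {V : Type*} (G : SimpleGraph V) (t : ℕ) (U : Set V) : Prop :=
  (G.openNeighborhood U).encard ≤ t

namespace SecludedClique

/-- An input of the problem: a graph `G` with vertex set `{0, …, n - 1}`, positive integer vertex
weights, a nonnegative integer `t` and a positive integer `w`. -/
structure Input : Type where
  n : ℕ
  G : SimpleGraph (Fin n)
  weight : Fin n → ℕ
  weight_pos : ∀ v, 0 < weight v
  t : ℕ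
  w : ℕ
  w_pos : 0 < w

/-- `G` contains a `t`-secluded clique of weight at least `w`; the clique is given by its
vertex set. -/
def Input.IsYes (I : Input) : Prop :=
  ∃ U : Finset (Fin I.n), I.G.IsClique (U : Set (Fin I.n)) ∧
    I.G.IsSecluded I.t (U : Set (Fin I.n)) ∧ I.w ≤ ∑ v ∈ U, I.weight v

open Classical in
/-- The initial configuration on an input. Registers `0`, `1`, `2` hold `n`, `t`, `w`. Memory cell
`v < n` holds the weight of the vertex `v`, and the cells `n + (u * n + v)` with `u, v < n` hold the
adjacency matrix. All other registers and cells are zero. -/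
noncomputable def Input.init (I : Input) : RAM.Config where
  pc := 0
  reg := fun i => if i = 0 then I.n else if i = 1 then I.t else if i = 2 then I.w else 0
  mem := fun a =>
    if h : a < I.n then I.weight ⟨a, h⟩
    else if ∃ u v : Fin I.n, a = I.n + (u * I.n + v) ∧ I.G.Adj u v then 1 else 0

end SecludedClique

/-!
The problem is solved by exhaustive search over `n * 4 ^ t` guesses, each tested in polynomial time
up to a factor `4 ^ O(t)`; since `4 ^ t ≤ 4 * 2 ^ (2 * t * log t)`, this is within the bound.

Let `S` be a nonempty `t`-secluded clique and `v ∈ S`. Then `S` is contained in the closed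
neighbourhood `W` of `v`, and every vertex of `W` outside `S` is a neighbour of `S`, so `W` has at
most `t` vertices outside `S`. Starting from `U = W`, two passes shrink `U` while keeping `S ⊆ U`.
The first goes through all pairs of vertices; when both lie in `U` and are not adjacent, one of them
is outside `S`, a binary guess tells which, and it is removed. The second goes through all vertices
`z`; when `z` is a neighbour of `U`, a binary guess tells whether `z` is a neighbour of `S`, and if
it is not, then all neighbours of `z` are removed from `U`. Correct guesses leave a clique `U`
containing `S` all of whose neighbours are neighbours of `S`, so that `U` is `t`-secluded and at
least as heavy as `S`. Every guess removes one of the at most `t` vertices of `W` outside `S`, or is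
charged to one of the at most `t` neighbours of `S`, so that `2 * t` guesses suffice. This is
`exists_candidate`. Whatever the guesses are, the result is a clique (`candidate_clique`), so a
final check of its neighbourhood and of its weight makes the search sound (`isYes_iff`).

The machine program is obtained from a structured program with counting loops, for which
`runsTo_compile` shows that the compiled code has the intended effect and that the running time is
a polynomial in the largest loop bound (`exists_time_le`). All loop bounds are `n`, `t` or `4 ^ t`,
and `eval_search` shows that the program carries out the search.
-/

/-! ### Structured programs and their compilation -/

namespace RAM

/-- The value of the state `s` after the updates `f 0`, …, `f (n - 1)`, in this order. -/
def forRange {α : Type*} (f : ℕ → α → α) (s : α) : ℕ → α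
  | 0 => s
  | n + 1 => f n (forRange f s n)

/-- A configuration without its program counter. -/
structure Store : Type where
  reg : ℕ → ℕ
  mem : ℕ → ℕ

/-- The store with register `d` set to `x`. -/
def Store.set (σ : Store) (d x : ℕ) : Store := ⟨Function.update σ.reg d x, σ.mem⟩

/-- The configuration with program counter `p` and the contents of `σ`. -/
def Store.at (σ : Store) (p : ℕ) : Config := ⟨p, σ.reg, σ.mem⟩

@[simp] lemma Store.set_mem (σ : Store) (d x : ℕ) : (σ.set d x).mem = σ.mem := rfl

@[simp] lemma Store.set_reg (σ : Store) (d x r : ℕ) :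
    (σ.set d x).reg r = if r = d then x else σ.reg r := by
  simp [Store.set, Function.update_apply]

/-- Structured programs: straight-line instructions, branching and counting loops. Every such
program terminates. -/
inductive Stmt : Type
  | skip
  | const (d c : ℕ)
  | add (d r s : ℕ)
  | sub (d r s : ℕ)
  | load (d r : ℕ)
  | store (r s : ℕ)
  | seq (S T : Stmt)
  /-- `if reg r < reg s then S else T` -/
  | ite (r s : ℕ) (S T : Stmt)
  /-- `for reg i := 0 to reg b - 1 do S` -/
  | loop (i b : ℕ) (S : Stmt)

namespace Stmt

/-- The effect of a structured program. For a loop this is the intended effect only if the body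
changes neither the loop variable nor the register that holds the bound. -/
def eval : Stmt → Store → Store
  | skip, σ => σ
  | const d c, σ => σ.set d c
  | add d r s, σ => σ.set d (σ.reg r + σ.reg s)
  | sub d r s, σ => σ.set d (σ.reg r - σ.reg s)
  | load d r, σ => σ.set d (σ.mem (σ.reg r))
  | store r s, σ => ⟨σ.reg, Function.update σ.mem (σ.reg r) (σ.reg s)⟩
  | seq S T, σ => T.eval (S.eval σ)
  | ite r s S T, σ => if σ.reg r < σ.reg s then S.eval σ else T.eval σ
  | loop i b S, σ => forRange (fun k τ => (S.eval τ).set i (k + 1)) (σ.set i 0) (σ.reg b)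

/-- The registers that a program may change. -/
def writes : Stmt → List ℕ
  | skip => []
  | const d _ => [d]
  | add d _ _ => [d]
  | sub d _ _ => [d]
  | load d _ => [d]
  | store _ _ => []
  | seq S T => S.writes ++ T.writes
  | ite _ _ S T => S.writes ++ T.writes
  | loop i _ S => i :: S.writes

/-- The registers that bound the loops of a program. -/
def bounds : Stmt → List ℕ
  | seq S T => S.bounds ++ T.bounds
  | ite _ _ S T => S.bounds ++ T.bounds
  | loop _ b S => b :: S.bounds
  | _ => []

/-- The program does not change the memory. -/
def storeFree : Stmt → Bool
  | store _ _ => false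
  | seq S T => S.storeFree && T.storeFree
  | ite _ _ S T => S.storeFree && T.storeFree
  | loop _ _ S => S.storeFree
  | _ => true

/-- No loop body changes the loop variable. -/
def countersFree : Stmt → Bool
  | seq S T => S.countersFree && T.countersFree
  | ite _ _ S T => S.countersFree && T.countersFree
  | loop i _ S => (!S.writes.contains i) && S.countersFree
  | _ => true

/-- The number of instructions of the compiled program. -/
def size : Stmt → ℕ
  | skip => 0
  | seq S T => S.size + T.size
  | ite _ _ S T => S.size + T.size + 2
  | loop _ _ S => S.size + 5
  | _ => 1

/-- The machine program for a structured program, to be placed at position `p`. Register `3` is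
assumed to hold the number one, which increments the loop variables. -/
def compile : Stmt → ℕ → List Instr
  | skip, _ => []
  | const d c, _ => [.const d c]
  | add d r s, _ => [.add d r s]
  | sub d r s, _ => [.sub d r s]
  | load d r, _ => [.load d r]
  | store r s, _ => [.store r s]
  | seq S T, p => S.compile p ++ T.compile (p + S.size)
  | ite r s S T, p =>
      .jumpLt r s (p + 2 + T.size) :: (T.compile (p + 1) ++
        (.jump (p + 2 + T.size + S.size) :: S.compile (p + 2 + T.size)))
  | loop i b S, p =>
      .const i 0 :: .jumpLt i b (p + 3) :: .jump (p + 5 + S.size) ::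
        (S.compile (p + 3) ++ [.add i i 3, .jump (p + 1)])

/-- A bound on the number of steps of the compiled program when all loop bounds are at most `M`. -/
def time (M : ℕ) : Stmt → ℕ
  | skip => 0
  | seq S T => S.time M + T.time M
  | ite _ _ S T => S.time M + T.time M + 2
  | loop _ _ S => M * (S.time M + 3) + 3
  | _ => 1

lemma length_compile (S : Stmt) (p : ℕ) : (S.compile p).length = S.size := by
  induction S generalizing p with
  | seq S T hS hT => simp [compile, size, hS, hT]
  | ite r s S T hS hT => simp [compile, size, hS, hT]; omega
  | loop i b S hS => simp [compile, size, hS]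
  | _ => simp [compile, size]

lemma eval_reg_of_notMem (S : Stmt) (σ : Store) {r : ℕ} (h : r ∉ S.writes) :
    (S.eval σ).reg r = σ.reg r := by
  induction S generalizing σ with
  | seq S T hS hT => simp_all [writes, eval]
  | ite r s S T hS hT => simp only [eval]; split_ifs <;> simp_all [writes]
  | loop i b S hS =>
    simp only [writes, List.mem_cons, not_or] at h
    simp only [eval]
    generalize σ.reg b = m
    induction m with
    | zero => simp [forRange, h.1]
    | succ m ih => simp [forRange, h.1, hS _ h.2, ih]
  | _ => simp_all [writes, eval]

lemma eval_mem_of_storeFree (S : Stmt) (σ : Store) (h : S.storeFree) :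
    (S.eval σ).mem = σ.mem := by
  induction S generalizing σ with
  | seq S T hS hT => simp_all [storeFree, eval]
  | ite r s S T hS hT => simp only [eval]; split_ifs <;> simp_all [storeFree]
  | loop i b S hS =>
    simp only [storeFree] at h
    simp only [eval]
    generalize σ.reg b = m
    induction m with
    | zero => simp [forRange]
    | succ m ih => simp [forRange, hS _ h, ih]
  | _ => simp_all [storeFree, eval]

/-- The proof rule for loops: an invariant, which may mention the number of completed rounds. -/
lemma eval_loop_induction {i b : ℕ} {S : Stmt} {σ : Store} (Inv : ℕ → Store → Prop)
    (h0 : Inv 0 (σ.set i 0))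
    (hs : ∀ k < σ.reg b, ∀ τ, τ.reg i = k → Inv k τ → Inv (k + 1) ((S.eval τ).set i (k + 1))) :
    Inv (σ.reg b) ((loop i b S).eval σ) := by
  simp only [eval]
  suffices ∀ m ≤ σ.reg b,
      (forRange (fun k τ => (S.eval τ).set i (k + 1)) (σ.set i 0) m).reg i = m ∧
      Inv m (forRange (fun k τ => (S.eval τ).set i (k + 1)) (σ.set i 0) m) from
    (this _ le_rfl).2
  intro m hm
  induction m with
  | zero => simpa [forRange] using h0
  | succ m ih =>
    obtain ⟨h1, h2⟩ := ih (by omega)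
    exact ⟨by simp [forRange], hs m (by omega) _ h1 h2⟩

/-- The code `l` stands in the program `P` at position `p`. -/
def CodeAt (P : Program) (p : ℕ) (l : List Instr) : Prop :=
  ∀ i, (h : i < l.length) → P[p + i]? = some l[i]

lemma CodeAt.left {P : Program} {p : ℕ} {l l' : List Instr} (h : CodeAt P p (l ++ l')) :
    CodeAt P p l := by
  intro i hi
  rw [h i (by simp; omega), List.getElem_append_left hi]

lemma CodeAt.right {P : Program} {p : ℕ} {l l' : List Instr} (h : CodeAt P p (l ++ l')) :
    CodeAt P (p + l.length) l' := by
  intro i hi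
  have := h (l.length + i) (by simp; omega)
  rw [← add_assoc] at this
  rw [this, List.getElem_append_right (by omega)]
  simp

lemma CodeAt.head {P : Program} {p : ℕ} {a : Instr} {l : List Instr} (h : CodeAt P p (a :: l)) :
    P[p]? = some a := by
  exact h 0 (Nat.succ_pos _)

lemma CodeAt.tail {P : Program} {p : ℕ} {a : Instr} {l : List Instr} (h : CodeAt P p (a :: l)) :
    CodeAt P (p + 1) l := by
  intro i hi
  have := h (i + 1) (by simp; omega)
  rw [show p + 1 + i = p + (i + 1) by omega, this]
  simp

/-- The program `P` takes the configuration `c` to `c'` within `T` steps. -/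
def RunsTo (P : Program) (c c' : Config) (T : ℕ) : Prop :=
  ∃ k ≤ T, (step P)^[k] c = c'

lemma RunsTo.refl (P : Program) (c : Config) : RunsTo P c c 0 := ⟨0, le_rfl, rfl⟩

lemma RunsTo.trans {P : Program} {c c' c'' : Config} {T T' : ℕ} (h : RunsTo P c c' T)
    (h' : RunsTo P c' c'' T') : RunsTo P c c'' (T + T') := by
  obtain ⟨k, hk, rfl⟩ := h
  obtain ⟨k', hk', rfl⟩ := h'
  exact ⟨k' + k, by omega, Function.iterate_add_apply _ _ _ _⟩

lemma RunsTo.mono {P : Program} {c c' : Config} {T T' : ℕ} (h : RunsTo P c c' T) (hT : T ≤ T') :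
    RunsTo P c c' T' := by
  obtain ⟨k, hk, h⟩ := h
  exact ⟨k, hk.trans hT, h⟩

lemma RunsTo.single {P : Program} {σ : Store} {p : ℕ} {a : Instr} (h : P[p]? = some a) :
    RunsTo P (σ.at p) (exec (σ.at p) a) 1 :=
  ⟨1, le_rfl, by simp [step, Store.at, h]⟩

/-- Correctness of the compiler, with the running time. -/
theorem runsTo_compile {P : Program} {M : ℕ} (S : Stmt) (p : ℕ) (σ : Store)
    (hP : CodeAt P p (S.compile p)) (hc : S.countersFree)
    (hb : ∀ r ∈ S.bounds, r ∉ S.writes) (hM : ∀ r ∈ S.bounds, σ.reg r ≤ M)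
    (h3 : 3 ∉ S.writes) (hσ : σ.reg 3 = 1) :
    RunsTo P (σ.at p) ((S.eval σ).at (p + S.size)) (S.time M) := by
  induction S generalizing p σ with
  | skip => exact RunsTo.refl _ _
  | const | add | sub | load | store => exact RunsTo.single hP.head
  | seq S T hS hT =>
    simp only [countersFree, Bool.and_eq_true] at hc
    simp only [bounds, writes, List.mem_append, not_or] at hb hM h3
    have h1 := hS p σ hP.left hc.1 (fun r hr => (hb r (.inl hr)).1) (fun r hr => hM r (.inl hr))
      h3.1 hσ
    have h2 := hT (p + S.size) (S.eval σ) (by simpa [length_compile] using hP.right) hc.2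
      (fun r hr => (hb r (.inr hr)).2)
      (fun r hr => by rw [eval_reg_of_notMem _ _ (hb r (.inr hr)).1]; exact hM r (.inr hr))
      h3.2 (by rw [eval_reg_of_notMem _ _ h3.1, hσ])
    simpa [eval, size, time, add_assoc] using h1.trans h2
  | ite r s S T hS hT =>
    simp only [countersFree, Bool.and_eq_true] at hc
    simp only [bounds, writes, List.mem_append, not_or] at hb hM h3
    have hjump := RunsTo.single (σ := σ) hP.head
    have hPT := hP.tail.left
    have hPS := hP.tail.right
    rw [length_compile] at hPS
    simp only [eval]
    split_ifs with hlt
    · have h1 := hS (p + 2 + T.size) σ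
        (by simpa [show p + 1 + T.size + 1 = p + 2 + T.size by omega] using hPS.tail) hc.1
        (fun r hr => (hb r (.inl hr)).1) (fun r hr => hM r (.inl hr)) h3.1 hσ
      have h0 : exec (σ.at p) (.jumpLt r s (p + 2 + T.size)) = σ.at (p + 2 + T.size) := by
        simp [exec, Store.at, hlt]
      rw [h0] at hjump
      have := hjump.trans h1
      rw [show p + 2 + T.size + S.size = p + (ite r s S T).size by simp [size]; omega] at this
      exact this.mono (by simp [time]; omega)
    · have h1 := hT (p + 1) σ hPT hc.2
        (fun r hr => (hb r (.inr hr)).2) (fun r hr => hM r (.inr hr)) h3.2 hσ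
      have h0 : exec (σ.at p) (.jumpLt r s (p + 2 + T.size)) = σ.at (p + 1) := by
        simp [exec, Store.at, hlt]
      rw [h0] at hjump
      have h2 := RunsTo.single (σ := T.eval σ) hPS.head
      have := (hjump.trans h1).trans h2
      have he : exec ((T.eval σ).at (p + 1 + T.size)) (.jump (p + 2 + T.size + S.size)) =
          (T.eval σ).at (p + (ite r s S T).size) := by
        simp only [exec, Store.at, size, Config.mk.injEq, and_self, and_true]; omega
      rw [he] at this
      exact this.mono (by simp [time]; omega)
  | loop i b S hS =>
    simp only [countersFree, Bool.and_eq_true, Bool.not_eq_true', List.contains_eq_mem,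
      decide_eq_false_iff_not] at hc
    simp only [bounds, writes, List.mem_cons, not_or] at hb hM h3
    have hPS := hP.tail.tail.tail
    have hPe := hPS.right
    rw [length_compile] at hPe
    set F : ℕ → Store := forRange (fun k τ => (S.eval τ).set i (k + 1)) (σ.set i 0) with hF
    have hFi : ∀ k, (F k).reg i = k := by
      intro k; cases k <;> simp [hF, forRange]
    have hFr : ∀ k r, r ≠ i → r ∉ S.writes → (F k).reg r = σ.reg r := by
      intro k r hr hw
      induction k with
      | zero => simp [hF, forRange, hr]
      | succ k ih =>
        rw [← ih]
        simp [hF, forRange, hr, eval_reg_of_notMem _ _ hw]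
    have hbi := hb b (.inl rfl)
    have h0 : RunsTo P (σ.at p) ((F 0).at (p + 1)) 1 := RunsTo.single hP.head
    have hstep : ∀ k < σ.reg b, RunsTo P ((F k).at (p + 1)) ((F (k + 1)).at (p + 1))
        (S.time M + 3) := by
      intro k hk
      have h1 := RunsTo.single (σ := F k) hP.tail.head
      have he : exec ((F k).at (p + 1)) (.jumpLt i b (p + 3)) = (F k).at (p + 3) := by
        have : (F k).reg i < (F k).reg b := by rwa [hFi, hFr k b hbi.1 hbi.2]
        simp [exec, Store.at, this]
      rw [he] at h1
      have h2 := hS (p + 3) (F k) hPS.left hc.2 (fun r hr => (hb r (.inr hr)).2)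
        (fun r hr => by
          rw [hFr k r (hb r (.inr hr)).1 (hb r (.inr hr)).2]; exact hM r (.inr hr))
        h3.2 (by rw [hFr k 3 h3.1 h3.2, hσ])
      have h3' := RunsTo.single (σ := S.eval (F k)) hPe.head
      have he' : exec ((S.eval (F k)).at (p + 3 + S.size)) (.add i i 3) =
          (F (k + 1)).at (p + 3 + S.size + 1) := by
        have hF' : F (k + 1) = (S.eval (F k)).set i (k + 1) := rfl
        simp only [exec, Store.at, Store.set, hF']
        rw [eval_reg_of_notMem S _ h3.2, eval_reg_of_notMem S _ hc.1, hFi,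
          hFr k 3 h3.1 h3.2, hσ]
      have h4 := RunsTo.single (σ := F (k + 1)) hPe.tail.head
      have h3'' : RunsTo P ((S.eval (F k)).at (p + 3 + S.size))
          ((F (k + 1)).at (p + 3 + S.size + 1)) 1 := he' ▸ h3'
      exact (((h1.trans h2).trans h3'').trans h4).mono (by omega)
    have hall : ∀ k ≤ σ.reg b, RunsTo P ((F 0).at (p + 1)) ((F k).at (p + 1))
        (k * (S.time M + 3)) := by
      intro k hk
      induction k with
      | zero => simpa using RunsTo.refl P _
      | succ k ih =>
        rw [add_mul, one_mul]
        exact (ih (by omega)).trans (hstep k (by omega))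
    have h1 := RunsTo.single (σ := F (σ.reg b)) hP.tail.head
    have he : exec ((F (σ.reg b)).at (p + 1)) (.jumpLt i b (p + 3)) =
        (F (σ.reg b)).at (p + 1 + 1) := by
      have : ¬ (F (σ.reg b)).reg i < (F (σ.reg b)).reg b := by
        rw [hFi, hFr _ b hbi.1 hbi.2]; exact lt_irrefl _
      simp [exec, Store.at, this]
    rw [he] at h1
    have h2 := RunsTo.single (σ := F (σ.reg b)) hP.tail.tail.head
    have hend : exec ((F (σ.reg b)).at (p + 1 + 1)) (.jump (p + 5 + S.size)) =
        ((loop i b S).eval σ).at (p + (loop i b S).size) := by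
      simp only [exec, Store.at, size, eval, hF, Config.mk.injEq, and_self, and_true]; omega
    rw [hend] at h2
    refine (((h0.trans (hall _ le_rfl)).trans h1).trans h2).mono ?_
    have := Nat.mul_le_mul_right (S.time M + 3) (hM b (.inl rfl))
    simp only [time]; omega

/-- The running time is polynomial in the largest loop bound. -/
lemma exists_time_le (S : Stmt) : ∃ c d : ℕ, ∀ M, S.time M ≤ c * (M + 1) ^ d := by
  have hpow : ∀ (M d d' : ℕ), (M + 1) ^ d ≤ (M + 1) ^ (d + d') := fun M d d' =>
    Nat.pow_le_pow_right (by omega) (by omega)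
  induction S with
  | seq S T hS hT =>
    obtain ⟨c, d, h⟩ := hS
    obtain ⟨c', d', h'⟩ := hT
    refine ⟨c + c', d + d', fun M => ?_⟩
    have h1 := Nat.mul_le_mul_left c (hpow M d d')
    have h2 := Nat.mul_le_mul_left c' (hpow M d' d)
    rw [add_comm d' d] at h2
    have := h M; have := h' M
    simp only [time, add_mul]; omega
  | ite r s S T hS hT =>
    obtain ⟨c, d, h⟩ := hS
    obtain ⟨c', d', h'⟩ := hT
    refine ⟨c + c' + 2, d + d', fun M => ?_⟩
    have h1 := Nat.mul_le_mul_left c (hpow M d d')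
    have h2 := Nat.mul_le_mul_left c' (hpow M d' d)
    rw [add_comm d' d] at h2
    have h3 : 1 ≤ (M + 1) ^ (d + d') := Nat.one_le_pow _ _ (by omega)
    have := h M; have := h' M
    simp only [time, add_mul]; omega
  | loop i b S hS =>
    obtain ⟨c, d, h⟩ := hS
    refine ⟨c + 6, d + 1, fun M => ?_⟩
    have h3 : 1 ≤ (M + 1) ^ d := Nat.one_le_pow _ _ (by omega)
    have := h M
    simp only [time, pow_succ]
    nlinarith [Nat.mul_le_mul_left M this, Nat.mul_le_mul_left M h3]
  | skip => exact ⟨0, 0, fun M => by simp [time]⟩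
  | _ => exact ⟨1, 0, fun M => by simp [time]⟩

end Stmt

end RAM

/-! ### Finding secluded cliques by binary guesses -/

namespace SecludedClique

open RAM Finset

open Classical in
/-- The open neighbourhood of `U` in the graph with vertex set `{0, …, n - 1}` and adjacency
relation `A`. -/
noncomputable def nbhd (n : ℕ) (A : ℕ → ℕ → Prop) (U : Finset ℕ) : Finset ℕ :=
  {z ∈ range n | z ∉ U ∧ ∃ u ∈ U, A z u}

lemma mem_nbhd {n : ℕ} {A : ℕ → ℕ → Prop} {U : Finset ℕ} {z : ℕ} :
    z ∈ nbhd n A U ↔ z < n ∧ z ∉ U ∧ ∃ u ∈ U, A z u := by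
  simp [nbhd]

open Classical in
/-- Treats the pair `x, y`: if both lie in the set and are not adjacent, the next guess decides
which of them is removed. The second component holds the guesses that are left, as the binary
digits of a number, the next one being the least significant. -/
noncomputable def splitPair (A : ℕ → ℕ → Prop) (x y : ℕ) (s : Finset ℕ × ℕ) : Finset ℕ × ℕ :=
  if x < y ∧ x ∈ s.1 ∧ y ∈ s.1 ∧ ¬ A x y then
    (if s.2 % 2 = 0 then s.1.erase x else s.1.erase y, s.2 / 2)
  else s

open Classical in
/-- Treats the vertex `z`: if it is a neighbour of the set, the next guess decides whether it stays
one or loses all its neighbours in the set. -/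
noncomputable def detach (n : ℕ) (A : ℕ → ℕ → Prop) (z : ℕ) (s : Finset ℕ × ℕ) : Finset ℕ × ℕ :=
  if z ∈ nbhd n A s.1 then
    (if s.2 % 2 = 0 then s.1 else s.1.filter fun u => ¬ A z u, s.2 / 2)
  else s

/-- Removes vertices until the set is a clique. -/
noncomputable def cliquePass (n : ℕ) (A : ℕ → ℕ → Prop) (s : Finset ℕ × ℕ) : Finset ℕ × ℕ :=
  forRange (fun x s => forRange (splitPair A x) s n) s n

/-- Decides for every vertex in turn whether it may be a neighbour. -/
noncomputable def detachPass (n : ℕ) (A : ℕ → ℕ → Prop) (s : Finset ℕ × ℕ) : Finset ℕ × ℕ :=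
  forRange (detach n A) s n

open Classical in
/-- The set found from the vertex `v` with the guesses `e`. -/
noncomputable def candidate (n : ℕ) (A : ℕ → ℕ → Prop) (v e : ℕ) : Finset ℕ :=
  (detachPass n A (cliquePass n A ({u ∈ range n | A v u}, e))).1

/-- Updates that only remove elements, the `i`-th of which establishes `Q i`, establish all the
`Q i`, provided that these pass to subsets. -/
lemma forRange_shrinks {f : ℕ → Finset ℕ × ℕ → Finset ℕ × ℕ} {Q : ℕ → Finset ℕ → Prop}
    (hQ : ∀ i U U', U' ⊆ U → Q i U → Q i U') (hf : ∀ i s, (f i s).1 ⊆ s.1 ∧ Q i (f i s).1)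
    (s : Finset ℕ × ℕ) (n : ℕ) :
    (forRange f s n).1 ⊆ s.1 ∧ ∀ i < n, Q i (forRange f s n).1 := by
  induction n with
  | zero => simp [forRange]
  | succ n ih =>
    refine ⟨(hf n _).1.trans ih.1, fun i hi => ?_⟩
    rcases Nat.lt_succ_iff_lt_or_eq.1 hi with h | rfl
    · exact hQ i _ _ (hf n _).1 (ih.2 i h)
    · exact (hf i _).2

lemma splitPair_spec (A : ℕ → ℕ → Prop) (x y : ℕ) (s : Finset ℕ × ℕ) :
    (splitPair A x y s).1 ⊆ s.1 ∧
      (x < y → x ∈ (splitPair A x y s).1 → y ∈ (splitPair A x y s).1 → A x y) := by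
  unfold splitPair
  split_ifs with h h'
  · exact ⟨erase_subset _ _, by simp⟩
  · exact ⟨erase_subset _ _, by simp⟩
  · exact ⟨Subset.rfl, fun h1 h2 h3 => by tauto⟩

lemma cliquePass_spec (n : ℕ) (A : ℕ → ℕ → Prop) (s : Finset ℕ × ℕ) :
    (cliquePass n A s).1 ⊆ s.1 ∧ ∀ x < n, ∀ y < n, x < y →
      x ∈ (cliquePass n A s).1 → y ∈ (cliquePass n A s).1 → A x y :=
  forRange_shrinks (Q := fun x U => ∀ y < n, x < y → x ∈ U → y ∈ U → A x y)
    (fun _ _ _ h hQ y hy hxy hx hy' => hQ y hy hxy (h hx) (h hy'))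
    (fun x s => forRange_shrinks (Q := fun y U => x < y → x ∈ U → y ∈ U → A x y)
      (fun _ _ _ h hQ hxy hx hy' => hQ hxy (h hx) (h hy')) (fun y s => splitPair_spec A x y s) s n)
    s n

lemma detach_subset (n : ℕ) (A : ℕ → ℕ → Prop) (z : ℕ) (s : Finset ℕ × ℕ) :
    (detach n A z s).1 ⊆ s.1 := by
  classical
  unfold detach
  split_ifs
  · exact Subset.rfl
  · exact filter_subset _ _
  · exact Subset.rfl

lemma detachPass_subset (n : ℕ) (A : ℕ → ℕ → Prop) (s : Finset ℕ × ℕ) :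
    (detachPass n A s).1 ⊆ s.1 :=
  (forRange_shrinks (Q := fun _ _ => True) (by simp) (fun z s => ⟨detach_subset n A z s, trivial⟩)
    s n).1

lemma candidate_subset (n : ℕ) (A : ℕ → ℕ → Prop) (v e : ℕ) : candidate n A v e ⊆ range n := by
  classical
  exact (detachPass_subset _ _ _).trans ((cliquePass_spec _ _ _).1.trans (filter_subset _ _))

lemma candidate_clique {n : ℕ} {A : ℕ → ℕ → Prop} {v e x y : ℕ} (hxy : x < y)
    (hx : x ∈ candidate n A v e) (hy : y ∈ candidate n A v e) : A x y :=
  (cliquePass_spec _ _ _).2 x (mem_range.1 (candidate_subset _ _ _ _ hx)) y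
    (mem_range.1 (candidate_subset _ _ _ _ hy)) hxy (detachPass_subset _ _ _ hx)
    (detachPass_subset _ _ _ hy)

/-- Some `k` guesses lead the procedure `F` from `U` to `U'`; further guesses are left over. -/
def Leads (F : Finset ℕ × ℕ → Finset ℕ × ℕ) (U U' : Finset ℕ) (k : ℕ) : Prop :=
  ∃ e₀ < 2 ^ k, ∀ e, F (U, e₀ + 2 ^ k * e) = (U', e)

lemma Leads.comp {F F' : Finset ℕ × ℕ → Finset ℕ × ℕ} {U U' U'' : Finset ℕ} {k k' : ℕ}
    (h : Leads F U U' k) (h' : Leads F' U' U'' k') : Leads (fun s => F' (F s)) U U'' (k + k') := by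
  obtain ⟨e, he, h⟩ := h
  obtain ⟨e', he', h'⟩ := h'
  refine ⟨e + 2 ^ k * e', ?_, fun e'' => ?_⟩
  · have := Nat.mul_le_mul_left (2 ^ k) (Nat.succ_le_of_lt he')
    rw [pow_add]; rw [Nat.mul_succ] at this; omega
  · simp only
    rw [show e + 2 ^ k * e' + 2 ^ (k + k') * e'' = e + 2 ^ k * (e' + 2 ^ k' * e'') by ring, h, h']

/-- If a step can be guided within `S` at the expense of a potential `μ`, then so can its
iteration. -/
lemma exists_leads_forRange {f : ℕ → Finset ℕ × ℕ → Finset ℕ × ℕ}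
    (R : ℕ → Finset ℕ → Prop) (μ : ℕ → Finset ℕ → ℕ)
    (hf : ∀ i U, R i U → ∃ U' k, Leads (f i) U U' k ∧ R (i + 1) U' ∧ k + μ (i + 1) U' ≤ μ i U)
    (U : Finset ℕ) (hU : R 0 U) (n : ℕ) :
    ∃ U' k, Leads (fun s => forRange f s n) U U' k ∧ R n U' ∧ k + μ n U' ≤ μ 0 U := by
  induction n with
  | zero => exact ⟨U, 0, ⟨0, by simp, by simp [forRange]⟩, hU, by simp⟩
  | succ n ih =>
    obtain ⟨U₁, k₁, h₁, hR, hμ⟩ := ih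
    obtain ⟨U₂, k₂, h₂, hR', hμ'⟩ := hf n U₁ hR
    exact ⟨U₂, k₁ + k₂, h₁.comp h₂, hR', by omega⟩

lemma exists_leads_splitPair {A : ℕ → ℕ → Prop} {S U : Finset ℕ} (x y : ℕ)
    (hS : ∀ x ∈ S, ∀ y ∈ S, A x y) (hU : S ⊆ U) :
    ∃ U' k, Leads (splitPair A x y) U U' k ∧ S ⊆ U' ∧ k + #U' ≤ #U := by
  by_cases h : x < y ∧ x ∈ U ∧ y ∈ U ∧ ¬ A x y
  · by_cases hx : x ∈ S
    · have hy : y ∉ S := fun hy => h.2.2.2 (hS x hx y hy)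
      refine ⟨U.erase y, 1, ⟨1, by simp, fun e => ?_⟩, subset_erase.2 ⟨hU, hy⟩, ?_⟩
      · rw [splitPair, if_pos h]
        simp [show (1 + 2 * e) % 2 = 1 by omega, show (1 + 2 * e) / 2 = e by omega]
      · rw [add_comm, card_erase_add_one h.2.2.1]
    · refine ⟨U.erase x, 1, ⟨0, by simp, fun e => ?_⟩, subset_erase.2 ⟨hU, hx⟩, ?_⟩
      · rw [splitPair, if_pos h]
        simp
      · rw [add_comm, card_erase_add_one h.2.1]
  · exact ⟨U, 0, ⟨0, by simp, fun e => by rw [splitPair, if_neg h]; simp⟩, hU, by simp⟩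

lemma exists_leads_cliquePass {n : ℕ} {A : ℕ → ℕ → Prop} {S U : Finset ℕ}
    (hS : ∀ x ∈ S, ∀ y ∈ S, A x y) (hU : S ⊆ U) :
    ∃ U' k, Leads (cliquePass n A) U U' k ∧ S ⊆ U' ∧ k + #U' ≤ #U :=
  exists_leads_forRange (fun _ U => S ⊆ U) (fun _ U => #U) (fun x U hU =>
    exists_leads_forRange (fun _ U => S ⊆ U) (fun _ U => #U)
      (fun y _ hU => exists_leads_splitPair x y hS hU) U hU n) U hU n

/-- Guided by the solution `S`, every vertex treated so far that is outside the initial set `W` and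
not a neighbour of `S` has lost its neighbours. A guess that lets a neighbour stay is paid for by a
neighbour of `S`, any other guess by a removed vertex. -/
lemma exists_leads_detachPass {n : ℕ} {A : ℕ → ℕ → Prop} {S W : Finset ℕ} (hW : S ⊆ W) :
    ∃ U k, Leads (detachPass n A) W U k ∧ S ⊆ U ∧ k + #U ≤ #W + #(nbhd n A S) ∧
      ∀ z < n, z ∉ W → z ∉ nbhd n A S → z ∉ nbhd n A U := by
  classical
  obtain ⟨U, k, h, ⟨hSU, hUW, hz⟩, hk⟩ := exists_leads_forRange (f := detach n A)
    (fun i U => S ⊆ U ∧ U ⊆ W ∧ ∀ z < i, z ∉ W → z ∉ nbhd n A S → z ∉ nbhd n A U)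
    (fun i U => #U + #{z ∈ nbhd n A S | i ≤ z})
    (by
      rintro i U ⟨hSU, hUW, hz⟩
      have hsub : {z ∈ nbhd n A S | i + 1 ≤ z} ⊆ {z ∈ nbhd n A S | i ≤ z} := fun z hz' => by
        simp only [mem_filter] at hz' ⊢; exact ⟨hz'.1, by omega⟩
      by_cases hi : i ∈ nbhd n A U
      · by_cases hiS : i ∈ nbhd n A S
        · refine ⟨U, 1, ⟨0, by simp, fun e => ?_⟩, ⟨hSU, hUW, fun z hzi hzW hzS => ?_⟩, ?_⟩
          · rw [detach, if_pos hi]; simp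
          · rcases Nat.lt_succ_iff_lt_or_eq.1 hzi with h | rfl
            · exact hz z h hzW hzS
            · exact absurd hiS hzS
          · have : #{z ∈ nbhd n A S | i + 1 ≤ z} < #{z ∈ nbhd n A S | i ≤ z} :=
              card_lt_card ⟨hsub, fun h => by
                have := h (mem_filter.2 ⟨hiS, le_rfl⟩)
                simp at this⟩
            omega
        · obtain ⟨hin, hiU, u, hu, hAu⟩ := mem_nbhd.1 hi
          have hsub' : U.filter (fun u => ¬ A i u) ⊆ U := filter_subset _ _
          refine ⟨U.filter fun u => ¬ A i u, 1, ⟨1, by simp, fun e => ?_⟩,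
            ⟨fun v hv => mem_filter.2 ⟨hSU hv, fun hA => ?_⟩, hsub'.trans hUW,
              fun z hzi hzW hzS hzU => ?_⟩, ?_⟩
          · rw [detach, if_pos hi]
            simp [show (1 + 2 * e) % 2 = 1 by omega, show (1 + 2 * e) / 2 = e by omega]
          · exact hiS (mem_nbhd.2 ⟨hin, fun h => hiU (hSU h), v, hv, hA⟩)
          · obtain ⟨hzn, -, u', hu', hA'⟩ := mem_nbhd.1 hzU
            rcases Nat.lt_succ_iff_lt_or_eq.1 hzi with h | rfl
            · exact hz z h hzW hzS (mem_nbhd.2 ⟨hzn, fun h => hzW (hUW h), u', hsub' hu', hA'⟩)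
            · exact (mem_filter.1 hu').2 hA'
          · have h1 := card_le_card hsub
            have h2 : #(U.filter fun u => ¬ A i u) < #U :=
              card_lt_card ⟨hsub', fun h => (mem_filter.1 (h hu)).2 hAu⟩
            omega
      · refine ⟨U, 0, ⟨0, by simp, fun e => by rw [detach, if_neg hi]; simp⟩,
          ⟨hSU, hUW, fun z hzi hzW hzS => ?_⟩, ?_⟩
        · rcases Nat.lt_succ_iff_lt_or_eq.1 hzi with h | rfl
          · exact hz z h hzW hzS
          · exact hi
        · have h1 := card_le_card hsub
          omega)
    W ⟨hW, Subset.rfl, by simp⟩ n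
  refine ⟨U, k, h, hSU, ?_, hz⟩
  simp only [zero_le, filter_true] at hk
  omega

/-- Every clique with at most `t` neighbours lies in a candidate with at most `t` neighbours that
is found with `2 * t` guesses. -/
theorem exists_candidate {n t : ℕ} {A : ℕ → ℕ → Prop} {S : Finset ℕ} (hsymm : ∀ x y, A x y → A y x)
    (hSn : S ⊆ range n) (hS : ∀ x ∈ S, ∀ y ∈ S, A x y) (hne : S.Nonempty)
    (ht : #(nbhd n A S) ≤ t) :
    ∃ v < n, ∃ e < 2 ^ (2 * t), S ⊆ candidate n A v e ∧ #(nbhd n A (candidate n A v e)) ≤ t := by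
  classical
  obtain ⟨v, hv⟩ := hne
  set W : Finset ℕ := {u ∈ range n | A v u} with hWdef
  have hSW : S ⊆ W := fun u hu => mem_filter.2 ⟨hSn hu, hS v hv u hu⟩
  -- A vertex of `W` outside `S` is a neighbour of `v`, so at most `t` vertices have to be removed.
  have hWS : ∀ z ∈ W, z ∉ S → z ∈ nbhd n A S := fun z hz hzS =>
    mem_nbhd.2 ⟨mem_range.1 (mem_filter.1 hz).1, hzS, v, hv, hsymm _ _ (mem_filter.1 hz).2⟩
  obtain ⟨U₁, k₁, h₁, hSU₁, hk₁⟩ := exists_leads_cliquePass (n := n) hS hSW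
  obtain ⟨U₂, k₂, h₂, hSU₂, hk₂, hz⟩ := exists_leads_detachPass (n := n) (A := A) hSU₁
  obtain ⟨e, he, h⟩ := h₁.comp h₂
  have hc : candidate n A v e = U₂ := by
    have := congrArg Prod.fst (h 0)
    simpa [candidate] using this
  have hcard : #W ≤ #S + t := by
    have h1 : W \ S ⊆ nbhd n A S := fun z hz => hWS z (mem_sdiff.1 hz).1 (mem_sdiff.1 hz).2
    have h2 := card_le_card h1
    have h3 := card_sdiff_add_card_eq_card hSW
    omega
  have hU₁W : U₁ ⊆ W := by
    obtain ⟨e', -, h'⟩ := h₁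
    have := (cliquePass_spec n A (W, e' + 2 ^ k₁ * 0)).1
    rwa [h' 0] at this
  have hc₂ := card_le_card hSU₂
  refine ⟨v, mem_range.1 (hSn hv), e, he.trans_le (Nat.pow_le_pow_right (by omega) (by omega)),
    hc ▸ hSU₂, (card_le_card ?_).trans ht⟩
  rw [hc]
  intro z hzU
  by_contra hzS
  obtain ⟨hzn, hzU₂, -⟩ := mem_nbhd.1 hzU
  have hzW : z ∉ W := fun h => hzS (hWS z h fun h' => hzU₂ (hSU₂ h'))
  exact hz z hzn (fun h => hzW (hU₁W h)) hzS hzU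

end SecludedClique

/-! ### The program -/

namespace RAM.Stmt

/-- The statements of a list, one after the other. -/
def block : List Stmt → Stmt
  | [] => skip
  | S :: l => seq S (block l)

@[simp] lemma eval_block_nil (σ : Store) : (block []).eval σ = σ := rfl

@[simp] lemma eval_block_cons (S : Stmt) (l : List Stmt) (σ : Store) :
    (block (S :: l)).eval σ = (block l).eval (S.eval σ) := rfl

/- Use of the registers: `0`, `1`, `2` hold `n`, `t`, `w` as in the input, `3` and `4` the constants
one and zero, `5` the number `4 ^ t` of sequences of guesses, `6` the address of the current set,
which is stored in `n` cells as its membership bits. These registers do not change during the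
search. Register `9` holds the guesses that are left, `22` the answer; registers `7`, `8` and `10`
to `14` are loop variables, and the others hold intermediate results. -/

/-- For registers `x` and `y` that hold vertices, sets register `16` to one if these are equal or
adjacent, and to zero otherwise. The loop computes the position of a row of the adjacency matrix. -/
def adjacent (x y : ℕ) : Stmt :=
  block [.add 15 0 4, .loop 14 0 (.ite 14 x (.add 15 15 0) .skip), .add 15 15 y, .load 16 15,
    .ite x y .skip (.ite y x .skip (.const 16 1))]

/-- Sets register `d` to one if the vertex in register `r` belongs to the current set, and to zero
otherwise. -/
def member (r d : ℕ) : Stmt := block [.add 15 6 r, .load d 15]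

/-- Puts the vertex in register `r` into the current set if register `s` holds one, and removes it
if register `s` holds zero. -/
def setMember (r s : ℕ) : Stmt := block [.add 15 6 r, .store 15 s]

/-- Moves the last binary digit of register `9` to register `18`, by repeated subtraction of two. -/
def draw : Stmt :=
  block [.const 19 0,
    .loop 14 5 (.ite 3 9 (block [.sub 9 9 3, .sub 9 9 3, .add 19 19 3]) .skip),
    .add 18 9 4, .add 9 19 4]

/-- Makes the closed neighbourhood of the vertex in register `7` the current set. -/
def initSet : Stmt := .loop 13 0 (block [adjacent 7 13, setMember 13 16])

/-- Implements `SecludedClique.splitPair` for the current set, the guesses in register `9`, and the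
vertices in the registers `10` and `11`. -/
def splitPair : Stmt :=
  block [member 10 20, member 11 21, adjacent 10 11,
    .ite 10 11 (.ite 4 20 (.ite 4 21 (.ite 4 16 .skip
      (block [draw, .ite 4 18 (setMember 11 4) (setMember 10 4)])) .skip) .skip) .skip]

/-- Sets register `17` to one if the vertex in register `12` is a neighbour of the current set, and
to zero otherwise. -/
def boundary : Stmt :=
  block [.const 17 0,
    .loop 13 0 (block [member 13 18, adjacent 12 13,
      .ite 4 18 (.ite 4 16 (.const 17 1) .skip) .skip]),
    member 12 18, .ite 4 18 (.const 17 0) .skip]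

/-- Removes the neighbours of the vertex in register `12` from the current set. -/
def removeNeighbours : Stmt :=
  .loop 13 0 (block [adjacent 12 13, .ite 4 16 (setMember 13 4) .skip])

/-- Implements `SecludedClique.detach` for the current set, the guesses in register `9`, and the
vertex in register `12`. -/
def detach : Stmt :=
  block [boundary, .ite 4 17 (block [draw, .ite 4 18 removeNeighbours .skip]) .skip]

/-- Sets register `22` to one if the current set has at most `t` neighbours and weight at least
`w`. -/
def check : Stmt :=
  block [.const 20 0, .const 21 0,
    .loop 12 0 (block [boundary, .add 20 20 17, member 12 18,
      .ite 4 18 (block [.load 19 12, .add 21 21 19]) .skip]),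
    .ite 1 20 .skip (.ite 21 2 .skip (.const 22 1))]

/-- Tests the candidate for the vertex in register `7` and the guesses in register `8`. -/
def tryCandidate : Stmt :=
  block [.add 9 8 4, initSet, .loop 10 0 (.loop 11 0 splitPair), .loop 12 0 detach, check]

/-- Tests all candidates; register `22` tells whether one of them has passed. -/
def search : Stmt := .loop 7 0 (.loop 8 5 tryCandidate)

/-- Sets register `5` to `4 ^ t`, the number of sequences of guesses, and register `6` to the
address of the current set, the first one after the input. -/
def setup : Stmt :=
  block [.const 5 1, .loop 14 1 (block [.add 5 5 5, .add 5 5 5]), .add 6 0 4,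
    .loop 14 0 (.add 6 6 0)]

end RAM.Stmt

/-! ### The program implements the branching procedure -/

namespace SecludedClique

open RAM Finset

/-- Vertices of the input graph, given as numbers, that are equal or adjacent. -/
def Input.Near (I : Input) (x y : ℕ) : Prop :=
  x = y ∨ ∃ (hx : x < I.n) (hy : y < I.n), I.G.Adj ⟨x, hx⟩ ⟨y, hy⟩

lemma Input.Near.symm {I : Input} {x y : ℕ} (h : I.Near x y) : I.Near y x := by
  rcases h with rfl | ⟨hx, hy, h⟩
  · exact .inl rfl
  · exact .inr ⟨hy, hx, h.symm⟩

/-- The set `U` has at most `t` neighbours and weight at least `w`. -/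
def Input.Accepts (I : Input) (U : Finset ℕ) : Prop :=
  #(nbhd I.n I.Near U) ≤ I.t ∧ I.w ≤ ∑ u ∈ U, I.init.mem u

open Classical in
lemma Input.init_mem_adj (I : Input) {x y : ℕ} (hx : x < I.n) (hy : y < I.n) :
    I.init.mem (I.n + (x * I.n + y)) = if I.G.Adj ⟨x, hx⟩ ⟨y, hy⟩ then 1 else 0 := by
  have key : (∃ u v : Fin I.n, I.n + (x * I.n + y) = I.n + (u * I.n + v) ∧ I.G.Adj u v) ↔
      I.G.Adj ⟨x, hx⟩ ⟨y, hy⟩ := by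
    refine ⟨?_, fun h => ⟨_, _, rfl, h⟩⟩
    rintro ⟨u, v, h, huv⟩
    have h1 : x * I.n + y = u * I.n + v := by omega
    have hpos : 0 < I.n := by omega
    have hxu : x = u := by
      have := congrArg (· / I.n) h1
      simpa [Nat.add_div_of_dvd_right, hpos, mul_comm _ I.n, Nat.mul_add_div hpos,
        Nat.div_eq_of_lt hy, Nat.div_eq_of_lt v.2] using this
    have hyv : y = v := by subst hxu; omega
    subst hxu hyv
    exact huv
  simp only [Input.init, key]
  rw [dif_neg (by omega)]

/-- The store holds the input `I`, the constants computed by `setup`, and the set `U` in the form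
of the sequence of its membership bits. -/
structure Represents (I : Input) (U : Finset ℕ) (σ : Store) : Prop where
  n : σ.reg 0 = I.n
  t : σ.reg 1 = I.t
  w : σ.reg 2 = I.w
  one : σ.reg 3 = 1
  zero : σ.reg 4 = 0
  guesses : σ.reg 5 = 2 ^ (2 * I.t)
  base : σ.reg 6 = I.n + I.n * I.n
  input : ∀ a < I.n + I.n * I.n, σ.mem a = I.init.mem a
  set : ∀ u < I.n, σ.mem (I.n + I.n * I.n + u) = if u ∈ U then 1 else 0

namespace Represents

variable {I : Input} {U : Finset ℕ} {σ : Store}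

lemma update (h : Represents I U σ) {d : ℕ} (x : ℕ) (hd : 7 ≤ d) : Represents I U (σ.set d x) := by
  have hne : ∀ r < 7, r ≠ d := fun r hr => by omega
  constructor <;> simp [hne, h.n, h.t, h.w, h.one, h.zero, h.guesses, h.base]
  · exact h.input
  · exact h.set

lemma eval (h : Represents I U σ) (S : Stmt) (hS : S.storeFree) (hw : ∀ r < 7, r ∉ S.writes) :
    Represents I U (S.eval σ) := by
  have hr : ∀ r < 7, (S.eval σ).reg r = σ.reg r := fun r hr => S.eval_reg_of_notMem σ (hw r hr)
  have hm := S.eval_mem_of_storeFree σ hS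
  constructor <;> simp [hr, hm, h.n, h.t, h.w, h.one, h.zero, h.guesses, h.base]
  · exact h.input
  · exact h.set

/-- Only the members of `U` below `n` are represented. -/
lemma congr (h : Represents I U σ) {U' : Finset ℕ} (hU : ∀ u < I.n, u ∈ U' ↔ u ∈ U) :
    Represents I U' σ :=
  { h with set := fun u hu => by rw [h.set u hu]; simp [hU u hu] }

lemma eval_member (h : Represents I U σ) {r d : ℕ} (hr : σ.reg r < I.n) :
    ((Stmt.member r d).eval σ).reg d = if σ.reg r ∈ U then 1 else 0 := by
  simp [Stmt.member, Stmt.eval, h.base, h.set _ hr]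

lemma eval_setMember (h : Represents I U σ) {r s : ℕ} {U' : Finset ℕ}
    (hs : s ≠ 15) (hrs : σ.reg s = if σ.reg r ∈ U' then 1 else 0)
    (hU : ∀ u < I.n, u ≠ σ.reg r → (u ∈ U' ↔ u ∈ U)) :
    Represents I U' ((Stmt.setMember r s).eval σ) := by
  have h' := h.eval (.add 15 6 r) rfl (by simp only [Stmt.writes, List.mem_singleton]; omega)
  refine { n := h'.n, t := h'.t, w := h'.w, one := h'.one, zero := h'.zero,
           guesses := h'.guesses, base := h'.base, input := fun a ha => ?_, set := fun u hu => ?_ }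
  · have : a ≠ I.n + I.n * I.n + σ.reg r := by omega
    simp [Stmt.setMember, Stmt.eval, h.base, this, h.input a ha]
  · by_cases hur : u = σ.reg r
    · simp [Stmt.setMember, Stmt.eval, h.base, hur, hs, hrs]
    · simp [Stmt.setMember, Stmt.eval, h.base, hur, h.set u hu, hU u hu hur]

open Classical in
lemma eval_adjacent (h : Represents I U σ) {x y : ℕ} (hx : 16 < x ∨ x < 14) (hy : 16 < y ∨ y < 14)
    (hxn : σ.reg x < I.n) (hyn : σ.reg y < I.n) :
    ((Stmt.adjacent x y).eval σ).reg 16 = if I.Near (σ.reg x) (σ.reg y) then 1 else 0 := by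
  have hx14 : x ≠ 14 := by omega
  have hx15 : x ≠ 15 := by omega
  have hx16 : x ≠ 16 := by omega
  have hy14 : y ≠ 14 := by omega
  have hy15 : y ≠ 15 := by omega
  have hy16 : y ≠ 16 := by omega
  simp only [Stmt.adjacent, Stmt.eval_block_cons, Stmt.eval_block_nil]
  set σ₁ := (Stmt.add 15 0 4).eval σ with hσ₁
  set L := Stmt.loop 14 0 (.ite 14 x (.add 15 15 0) .skip) with hL
  have hloop : (L.eval σ₁).reg 15 = I.n + I.n * min I.n (σ.reg x) ∧
      (L.eval σ₁).reg x = σ.reg x ∧ (L.eval σ₁).reg y = σ.reg y ∧ (L.eval σ₁).reg 0 = I.n := by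
    have h1 : σ₁.reg 0 = I.n := by simp [hσ₁, Stmt.eval, h.n]
    have := Stmt.eval_loop_induction (i := 14) (b := 0) (σ := σ₁)
      (S := .ite 14 x (.add 15 15 0) .skip)
      (fun k τ => τ.reg 15 = I.n + I.n * min k (σ.reg x) ∧ τ.reg x = σ.reg x ∧
        τ.reg y = σ.reg y ∧ τ.reg 0 = I.n)
      (by simp [hσ₁, Stmt.eval, h.n, h.zero, hx14, hx15, hy14, hy15])
      (by
        rintro k - τ hk ⟨h15, hτx, hτy, h0⟩
        by_cases hlt : k < σ.reg x
        · simp [Stmt.eval, hk, hτx, hτy, h0, h15, hlt, hx14, hx15, hy14, hy15,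
            min_eq_left hlt.le]
          ring
        · simp [Stmt.eval, hk, hτx, hτy, h0, h15, hlt, hx14, hy14,
            min_eq_right (not_lt.1 hlt), min_eq_right ((not_lt.1 hlt).trans (Nat.le_succ k))])
    rwa [h1] at this
  have hmem : (L.eval σ₁).mem = σ.mem := by
    rw [Stmt.eval_mem_of_storeFree _ _ rfl, hσ₁, Stmt.eval_mem_of_storeFree _ _ rfl]
  rw [min_eq_right hxn.le] at hloop
  generalize L.eval σ₁ = τ at hloop hmem ⊢
  obtain ⟨h15, hτx, hτy, -⟩ := hloop
  have haddr : I.n + I.n * σ.reg x + σ.reg y = I.n + (σ.reg x * I.n + σ.reg y) := by ring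
  have hin : I.n + (σ.reg x * I.n + σ.reg y) < I.n + I.n * I.n := by
    have := Nat.mul_le_mul_right I.n (Nat.succ_le_of_lt hxn)
    rw [Nat.succ_mul] at this; omega
  have hval := h.input _ hin
  rw [I.init_mem_adj hxn hyn] at hval
  rcases lt_trichotomy (σ.reg x) (σ.reg y) with hlt | heq | hlt
  · simp [Stmt.eval, hτx, hτy, h15, hmem, haddr, hval, hlt, hx15, hx16, hy15, hy16, Input.Near,
      hlt.ne, hxn, hyn]
  · simp [Stmt.eval, hτx, hτy, heq, hx15, hx16, hy15, hy16, Input.Near]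
  · simp [Stmt.eval, hτx, hτy, h15, hmem, haddr, hval, hlt, hlt.not_gt, hx15, hx16, hy15, hy16,
      Input.Near, hlt.ne', hxn, hyn]

/-- Drawing halves the number that encodes the guesses; the loop runs often enough because the number
is at most its bound. -/
lemma eval_draw (h : Represents I U σ) (he : σ.reg 9 ≤ 2 ^ (2 * I.t)) :
    (Stmt.draw.eval σ).reg 18 = σ.reg 9 % 2 ∧ (Stmt.draw.eval σ).reg 9 = σ.reg 9 / 2 := by
  simp only [Stmt.draw, Stmt.eval_block_cons, Stmt.eval_block_nil]
  set σ₁ := (Stmt.const 19 0).eval σ with hσ₁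
  have h5 : σ₁.reg 5 = 2 ^ (2 * I.t) := by simp [hσ₁, Stmt.eval, h.guesses]
  have := Stmt.eval_loop_induction (i := 14) (b := 5) (σ := σ₁)
    (S := .ite 3 9 (Stmt.block [.sub 9 9 3, .sub 9 9 3, .add 19 19 3]) .skip)
    (fun k τ => τ.reg 9 = σ.reg 9 - 2 * min k (σ.reg 9 / 2) ∧ τ.reg 19 = min k (σ.reg 9 / 2) ∧
      τ.reg 3 = 1 ∧ τ.reg 4 = 0)
    (by simp [hσ₁, Stmt.eval, h.one, h.zero])
    (by
      rintro k - τ hk ⟨h9, h19, h3, h4⟩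
      by_cases hlt : 1 < τ.reg 9
      · have hlt' := hlt
        rw [h9] at hlt'
        simp only [Stmt.eval, h3, hlt, if_true, Stmt.eval_block_cons, Stmt.eval_block_nil]
        simp [h3, h4, h9, h19]
        omega
      · have hlt' := hlt
        rw [h9] at hlt'
        simp only [Stmt.eval, h3, hlt, if_false]
        simp [h3, h4, h9, h19]
        omega)
  rw [h5] at this
  generalize Stmt.eval _ σ₁ = τ at this ⊢
  obtain ⟨h9, h19, -, h4⟩ := this
  simp [Stmt.eval, h9, h19, h4]
  omega

open Classical in
/-- The current set before the call is irrelevant: every membership bit is overwritten. -/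
lemma eval_initSet (h : Represents I U σ) (hv : σ.reg 7 < I.n) :
    Represents I ({u ∈ range I.n | I.Near (σ.reg 7) u}) (Stmt.initSet.eval σ) := by
  have := Stmt.eval_loop_induction (i := 13) (b := 0) (σ := σ)
    (S := Stmt.block [Stmt.adjacent 7 13, Stmt.setMember 13 16])
    (fun k τ => τ.reg 7 = σ.reg 7 ∧
      Represents I ({u ∈ range k | I.Near (σ.reg 7) u} ∪ {u ∈ U | k ≤ u}) τ)
    ⟨by simp, (h.update 0 (by norm_num)).congr (by simp)⟩
    (by
      rintro k hk τ hτk ⟨h7, hτ⟩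
      rw [h.n] at hk
      refine ⟨?_, Represents.update ?_ _ (by norm_num)⟩
      · rw [Store.set_reg, if_neg (by norm_num), Stmt.eval_reg_of_notMem _ _ (by decide), h7]
      · simp only [Stmt.eval_block_cons, Stmt.eval_block_nil]
        have h13 : ((Stmt.adjacent 7 13).eval τ).reg 13 = k := by
          rw [Stmt.eval_reg_of_notMem _ _ (by decide), hτk]
        refine (hτ.eval (Stmt.adjacent 7 13) rfl (by decide)).eval_setMember (by norm_num) ?_ ?_
        · rw [hτ.eval_adjacent (by norm_num) (by norm_num) (by rw [h7]; exact hv)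
            (by rw [hτk]; exact hk), h13, hτk, h7]
          simp
        · intro u _ huk
          rw [h13] at huk
          simp only [mem_union, mem_filter, mem_range]
          have h1 : u < k + 1 ↔ u < k := by omega
          have h2 : k + 1 ≤ u ↔ k ≤ u := by omega
          rw [h1, h2])
  rw [h.n] at this
  refine this.2.congr fun u hu => ?_
  simp [hu]

lemma eval_splitPair {s : Finset ℕ × ℕ} (h : Represents I s.1 σ) (hs : σ.reg 9 = s.2)
    (he : s.2 ≤ 2 ^ (2 * I.t)) (hx : σ.reg 10 < I.n) (hy : σ.reg 11 < I.n) :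
    Represents I (splitPair I.Near (σ.reg 10) (σ.reg 11) s).1 (Stmt.splitPair.eval σ) ∧
      (Stmt.splitPair.eval σ).reg 9 = (splitPair I.Near (σ.reg 10) (σ.reg 11) s).2 ∧
      (splitPair I.Near (σ.reg 10) (σ.reg 11) s).2 ≤ 2 ^ (2 * I.t) := by
  classical
  simp only [Stmt.splitPair, Stmt.eval_block_cons, Stmt.eval_block_nil]
  set σ₁ := (Stmt.member 10 20).eval σ with hσ₁
  set σ₂ := (Stmt.member 11 21).eval σ₁ with hσ₂
  set σ₃ := (Stmt.adjacent 10 11).eval σ₂ with hσ₃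
  have h₁ : Represents I s.1 σ₁ := h.eval _ rfl (by decide)
  have h₂ : Represents I s.1 σ₂ := h₁.eval _ rfl (by decide)
  have h₃ : Represents I s.1 σ₃ := h₂.eval _ rfl (by decide)
  have e₁ : ∀ r, r ∉ (Stmt.member 10 20).writes → σ₁.reg r = σ.reg r := fun r hr =>
    Stmt.eval_reg_of_notMem _ _ hr
  have e₂ : ∀ r, r ∉ (Stmt.member 11 21).writes → σ₂.reg r = σ₁.reg r := fun r hr =>
    Stmt.eval_reg_of_notMem _ _ hr
  have e₃ : ∀ r, r ∉ (Stmt.adjacent 10 11).writes → σ₃.reg r = σ₂.reg r := fun r hr =>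
    Stmt.eval_reg_of_notMem _ _ hr
  have h20 : σ₃.reg 20 = if σ.reg 10 ∈ s.1 then 1 else 0 := by
    rw [e₃ 20 (by decide), e₂ 20 (by decide), hσ₁, h.eval_member hx]
  have h21 : σ₃.reg 21 = if σ.reg 11 ∈ s.1 then 1 else 0 := by
    rw [e₃ 21 (by decide), hσ₂, h₁.eval_member (by rwa [e₁ 11 (by decide)]), e₁ 11 (by decide)]
  have h10' : σ₂.reg 10 = σ.reg 10 := by rw [e₂ 10 (by decide), e₁ 10 (by decide)]
  have h11' : σ₂.reg 11 = σ.reg 11 := by rw [e₂ 11 (by decide), e₁ 11 (by decide)]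
  have h16 : σ₃.reg 16 = if I.Near (σ.reg 10) (σ.reg 11) then 1 else 0 := by
    rw [hσ₃, h₂.eval_adjacent (by norm_num) (by norm_num) (by rwa [h10']) (by rwa [h11']), h10',
      h11']
  have h10 : σ₃.reg 10 = σ.reg 10 := by rw [e₃ 10 (by decide), h10']
  have h11 : σ₃.reg 11 = σ.reg 11 := by rw [e₃ 11 (by decide), h11']
  have h9 : σ₃.reg 9 = s.2 := by
    rw [e₃ 9 (by decide), e₂ 9 (by decide), e₁ 9 (by decide), hs]
  clear_value σ₃
  by_cases hc : σ.reg 10 < σ.reg 11 ∧ σ.reg 10 ∈ s.1 ∧ σ.reg 11 ∈ s.1 ∧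
      ¬ I.Near (σ.reg 10) (σ.reg 11)
  · obtain ⟨hd, hd'⟩ := h₃.eval_draw (h9 ▸ he)
    have h₄ : Represents I s.1 (Stmt.draw.eval σ₃) := h₃.eval _ rfl (by decide)
    have h10d : (Stmt.draw.eval σ₃).reg 10 = σ.reg 10 := by
      rw [Stmt.eval_reg_of_notMem _ _ (by decide), h10]
    have h11d : (Stmt.draw.eval σ₃).reg 11 = σ.reg 11 := by
      rw [Stmt.eval_reg_of_notMem _ _ (by decide), h11]
    rw [splitPair, if_pos hc]
    simp only [Stmt.eval, h10, h11, hc.1, h₃.zero, h20, h21, h16, hc.2.1, hc.2.2.1, hc.2.2.2,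
      if_true, if_false, zero_lt_one, lt_irrefl, Stmt.eval_block_cons, Stmt.eval_block_nil,
      h₄.zero, hd, h9]
    rw [h9] at hd'
    refine ⟨?_, ?_, by omega⟩
    · split_ifs with h1 h2 h2
      · omega
      · exact h₄.eval_setMember (by norm_num) (by simp [h10d, h₄.zero])
          (by rw [h10d]; intro u _ hu; simp [hu])
      · exact h₄.eval_setMember (by norm_num) (by simp [h11d, h₄.zero])
          (by rw [h11d]; intro u _ hu; simp [hu])
      · omega
    · split_ifs <;> rw [Stmt.eval_reg_of_notMem _ _ (by decide), hd']
  · rw [splitPair, if_neg hc]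
    have : Stmt.eval (.ite 10 11 (.ite 4 20 (.ite 4 21 (.ite 4 16 .skip
      (Stmt.block [Stmt.draw, .ite 4 18 (Stmt.setMember 11 4) (Stmt.setMember 10 4)]))
        .skip) .skip) .skip) σ₃ = σ₃ := by
      simp only [Stmt.eval, h10, h11, h₃.zero, h20, h21, h16]
      split_ifs <;> first | rfl | (exfalso; simp_all)
    rw [this]
    exact ⟨h₃, h9, he⟩

lemma eval_boundary (h : Represents I U σ) (hz : σ.reg 12 < I.n) (hU : U ⊆ range I.n) :
    (Stmt.boundary.eval σ).reg 17 = if σ.reg 12 ∈ nbhd I.n I.Near U then 1 else 0 := by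
  classical
  simp only [Stmt.boundary, Stmt.eval_block_cons, Stmt.eval_block_nil]
  set σ₁ := (Stmt.const 17 0).eval σ with hσ₁
  have h₁ : Represents I U σ₁ := h.eval _ rfl (by decide)
  have h12 : σ₁.reg 12 = σ.reg 12 := Stmt.eval_reg_of_notMem _ _ (by decide)
  have := Stmt.eval_loop_induction (i := 13) (b := 0) (σ := σ₁)
    (S := Stmt.block [Stmt.member 13 18, Stmt.adjacent 12 13,
      .ite 4 18 (.ite 4 16 (.const 17 1) .skip) .skip])
    (fun k τ => Represents I U τ ∧ τ.reg 12 = σ.reg 12 ∧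
      τ.reg 17 = if ∃ u < k, u ∈ U ∧ I.Near (σ.reg 12) u then 1 else 0)
    ⟨h₁.update _ (by norm_num), by simp [h12], by simp [hσ₁, Stmt.eval]⟩
    (by
      rintro k hk τ hτk ⟨hτ, hτ12, hτ17⟩
      rw [h₁.n] at hk
      refine ⟨(hτ.eval _ rfl (by decide)).update _ (by norm_num), ?_, ?_⟩
      · rw [Store.set_reg, if_neg (by norm_num), Stmt.eval_reg_of_notMem _ _ (by decide), hτ12]
      · simp only [Store.set_reg, Stmt.eval_block_cons, Stmt.eval_block_nil]
        set τ₁ := (Stmt.member 13 18).eval τ with hτ₁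
        have ht₁ : Represents I U τ₁ := hτ.eval _ rfl (by decide)
        set τ₂ := (Stmt.adjacent 12 13).eval τ₁ with hτ₂
        have ht₂ : Represents I U τ₂ := ht₁.eval _ rfl (by decide)
        have a12 : τ₁.reg 12 = σ.reg 12 := by
          rw [hτ₁, Stmt.eval_reg_of_notMem _ _ (by decide), hτ12]
        have a13 : τ₁.reg 13 = k := by rw [hτ₁, Stmt.eval_reg_of_notMem _ _ (by decide), hτk]
        have b18 : τ₂.reg 18 = if k ∈ U then 1 else 0 := by
          rw [hτ₂, Stmt.eval_reg_of_notMem _ _ (by decide), hτ₁,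
            hτ.eval_member (by rwa [hτk]), hτk]
        have b17 : τ₂.reg 17 = τ.reg 17 := by
          rw [hτ₂, Stmt.eval_reg_of_notMem _ _ (by decide), hτ₁,
            Stmt.eval_reg_of_notMem _ _ (by decide)]
        have b16 : τ₂.reg 16 = if I.Near (σ.reg 12) k then 1 else 0 := by
          rw [hτ₂, ht₁.eval_adjacent (by norm_num) (by norm_num) (by rwa [a12]) (by rwa [a13]),
            a12, a13]
        clear_value τ₂
        have hsucc : (∃ u < k + 1, u ∈ U ∧ I.Near (σ.reg 12) u) ↔
            (k ∈ U ∧ I.Near (σ.reg 12) k) ∨ ∃ u < k, u ∈ U ∧ I.Near (σ.reg 12) u := by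
          constructor
          · rintro ⟨u, hu, hu'⟩
            rcases Nat.lt_succ_iff_lt_or_eq.1 hu with h | rfl
            · exact .inr ⟨u, h, hu'⟩
            · exact .inl hu'
          · rintro (h | ⟨u, hu, hu'⟩)
            · exact ⟨k, by omega, h⟩
            · exact ⟨u, by omega, hu'⟩
        simp only [Stmt.eval, ht₂.zero, b18, b16, hsucc]
        by_cases hkU : k ∈ U <;> by_cases hN : I.Near (σ.reg 12) k <;>
          simp [hkU, hN, b17, hτ17])
  rw [h₁.n] at this
  generalize Stmt.eval _ σ₁ = τ at this ⊢
  obtain ⟨hτ, hτ12, hτ17⟩ := this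
  set τ' := (Stmt.member 12 18).eval τ with hτ'
  have h' : Represents I U τ' := hτ.eval _ rfl (by decide)
  have b18 : τ'.reg 18 = if σ.reg 12 ∈ U then 1 else 0 := by
    rw [hτ', hτ.eval_member (by rwa [hτ12]), hτ12]
  have b17 : τ'.reg 17 = τ.reg 17 := by
    rw [hτ', Stmt.eval_reg_of_notMem _ _ (by decide)]
  have hiff : (∃ u < I.n, u ∈ U ∧ I.Near (σ.reg 12) u) ↔ ∃ u ∈ U, I.Near (σ.reg 12) u :=
    ⟨fun ⟨u, _, h⟩ => ⟨u, h⟩, fun ⟨u, h⟩ => ⟨u, mem_range.1 (hU h.1), h⟩⟩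
  simp only [Stmt.eval, h'.zero, b18, mem_nbhd, hz, true_and]
  by_cases hzU : σ.reg 12 ∈ U <;> simp [hzU, b17, hτ17, hiff]

open Classical in
lemma eval_removeNeighbours (h : Represents I U σ) (hz : σ.reg 12 < I.n) :
    Represents I (U.filter fun u => ¬ I.Near (σ.reg 12) u) (Stmt.removeNeighbours.eval σ) := by
  have := Stmt.eval_loop_induction (i := 13) (b := 0) (σ := σ)
    (S := Stmt.block [Stmt.adjacent 12 13, .ite 4 16 (Stmt.setMember 13 4) .skip])
    (fun k τ => τ.reg 12 = σ.reg 12 ∧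
      Represents I {u ∈ U | u < k → ¬ I.Near (σ.reg 12) u} τ)
    ⟨by simp, (h.update 0 (by norm_num)).congr (by simp)⟩
    (by
      rintro k hk τ hτk ⟨h12, hτ⟩
      rw [h.n] at hk
      refine ⟨?_, Represents.update ?_ _ (by norm_num)⟩
      · rw [Store.set_reg, if_neg (by norm_num), Stmt.eval_reg_of_notMem _ _ (by decide), h12]
      · simp only [Stmt.eval_block_cons, Stmt.eval_block_nil]
        set τ₁ := (Stmt.adjacent 12 13).eval τ with hτ₁
        have h₁ : Represents I _ τ₁ := hτ.eval _ rfl (by decide)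
        have h13 : τ₁.reg 13 = k := by rw [hτ₁, Stmt.eval_reg_of_notMem _ _ (by decide), hτk]
        have h16 : τ₁.reg 16 = if I.Near (σ.reg 12) k then 1 else 0 := by
          rw [hτ₁, hτ.eval_adjacent (by norm_num) (by norm_num) (by rwa [h12]) (by rwa [hτk]),
            h12, hτk]
        clear_value τ₁
        have hlt : ∀ u, u ≠ k → (u < k + 1 ↔ u < k) := fun u hu => by omega
        simp only [Stmt.eval, h₁.zero, h16]
        by_cases hN : I.Near (σ.reg 12) k
        · simp only [hN, if_true, zero_lt_one]
          refine h₁.eval_setMember (by norm_num) (by simp [h13, h₁.zero, hN]) ?_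
          intro u _ hu
          rw [h13] at hu
          simp only [mem_filter, hlt u hu]
        · simp only [hN, if_false, lt_irrefl]
          refine h₁.congr fun u _ => ?_
          by_cases hu : u = k
          · simp [hu, hN]
          · simp only [mem_filter, hlt u hu])
  rw [h.n] at this
  refine this.2.congr fun u hu => ?_
  simp [hu]

lemma eval_detach {s : Finset ℕ × ℕ} (h : Represents I s.1 σ) (hs : σ.reg 9 = s.2)
    (he : s.2 ≤ 2 ^ (2 * I.t)) (hz : σ.reg 12 < I.n) (hU : s.1 ⊆ range I.n) :
    Represents I (detach I.n I.Near (σ.reg 12) s).1 (Stmt.detach.eval σ) ∧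
      (Stmt.detach.eval σ).reg 9 = (detach I.n I.Near (σ.reg 12) s).2 ∧
      (detach I.n I.Near (σ.reg 12) s).2 ≤ 2 ^ (2 * I.t) := by
  classical
  simp only [Stmt.detach, Stmt.eval_block_cons, Stmt.eval_block_nil]
  set σ₁ := Stmt.boundary.eval σ with hσ₁
  have h₁ : Represents I s.1 σ₁ := h.eval _ rfl (by decide)
  have h17 := h.eval_boundary hz hU
  rw [← hσ₁] at h17
  have h12 : σ₁.reg 12 = σ.reg 12 := by rw [hσ₁, Stmt.eval_reg_of_notMem _ _ (by decide)]
  have h9 : σ₁.reg 9 = s.2 := by rw [hσ₁, Stmt.eval_reg_of_notMem _ _ (by decide), hs]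
  clear_value σ₁
  by_cases hc : σ.reg 12 ∈ nbhd I.n I.Near s.1
  · rw [if_pos hc] at h17
    obtain ⟨hd, hd'⟩ := h₁.eval_draw (h9 ▸ he)
    have h₂ : Represents I s.1 (Stmt.draw.eval σ₁) := h₁.eval _ rfl (by decide)
    have h12' : (Stmt.draw.eval σ₁).reg 12 = σ.reg 12 := by
      rw [Stmt.eval_reg_of_notMem _ _ (by decide), h12]
    rw [detach, if_pos hc]
    rw [h9] at hd hd'
    simp only [Stmt.eval, h₁.zero, h17, zero_lt_one, if_true, Stmt.eval_block_cons,
      Stmt.eval_block_nil, h₂.zero, hd]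
    refine ⟨?_, ?_, by omega⟩
    · split_ifs with h1 h2 h2
      · omega
      · exact h₂
      · have := h₂.eval_removeNeighbours (by rwa [h12'])
        rwa [h12'] at this
      · omega
    · split_ifs
      · rw [Stmt.eval_reg_of_notMem _ _ (by decide), hd']
      · exact hd'
  · rw [if_neg hc] at h17
    rw [detach, if_neg hc]
    simp only [Stmt.eval, h₁.zero, h17, lt_irrefl, if_false]
    exact ⟨h₁, h9, he⟩

open Classical in
lemma eval_check (h : Represents I U σ) (hU : U ⊆ range I.n) :
    (Stmt.check.eval σ).reg 22 = if I.Accepts U then 1 else σ.reg 22 := by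
  simp only [Stmt.check, Stmt.eval_block_cons, Stmt.eval_block_nil]
  set σ₁ := (Stmt.const 21 0).eval ((Stmt.const 20 0).eval σ) with hσ₁
  have h₁ : Represents I U σ₁ := (h.eval _ rfl (by decide)).eval _ rfl (by decide)
  have := Stmt.eval_loop_induction (i := 12) (b := 0) (σ := σ₁)
    (S := Stmt.block [Stmt.boundary, .add 20 20 17, Stmt.member 12 18,
      .ite 4 18 (Stmt.block [.load 19 12, .add 21 21 19]) .skip])
    (fun k τ => Represents I U τ ∧ τ.reg 22 = σ.reg 22 ∧
      τ.reg 20 = (∑ i ∈ range k, if i ∈ nbhd I.n I.Near U then 1 else 0) ∧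
      τ.reg 21 = ∑ i ∈ range k, if i ∈ U then I.init.mem i else 0)
    ⟨h₁.update _ (by norm_num), by simp [hσ₁, Stmt.eval], by simp [hσ₁, Stmt.eval],
      by simp [hσ₁, Stmt.eval]⟩
    (by
      rintro k hk τ hτk ⟨hτ, hτ22, hτ20, hτ21⟩
      rw [h₁.n] at hk
      refine ⟨(hτ.eval _ rfl (by decide)).update _ (by norm_num), ?_, ?_⟩
      · rw [Store.set_reg, if_neg (by norm_num), Stmt.eval_reg_of_notMem _ _ (by decide), hτ22]
      · simp only [Store.set_reg, Stmt.eval_block_cons, Stmt.eval_block_nil, sum_range_succ]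
        set τ₁ := Stmt.boundary.eval τ with hτ₁
        have ht₁ : Represents I U τ₁ := hτ.eval _ rfl (by decide)
        have b17 := hτ.eval_boundary (by rwa [hτk]) hU
        rw [hτk, ← hτ₁] at b17
        set τ₂ := (Stmt.add 20 20 17).eval τ₁ with hτ₂
        have ht₂ : Represents I U τ₂ := ht₁.eval _ rfl (by decide)
        have c12 : τ₂.reg 12 = k := by
          rw [hτ₂, Stmt.eval_reg_of_notMem _ _ (by decide), hτ₁,
            Stmt.eval_reg_of_notMem _ _ (by decide), hτk]
        have c20 : τ₂.reg 20 = τ.reg 20 + τ₁.reg 17 := by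
          simp only [hτ₂, Stmt.eval, Store.set_reg, if_true]
          rw [hτ₁, Stmt.eval_reg_of_notMem _ _ (by decide)]
        have c21 : τ₂.reg 21 = τ.reg 21 := by
          rw [hτ₂, Stmt.eval_reg_of_notMem _ _ (by decide), hτ₁,
            Stmt.eval_reg_of_notMem _ _ (by decide)]
        set τ₃ := (Stmt.member 12 18).eval τ₂ with hτ₃
        have ht₃ : Represents I U τ₃ := ht₂.eval _ rfl (by decide)
        have d18 : τ₃.reg 18 = if k ∈ U then 1 else 0 := by
          rw [hτ₃, ht₂.eval_member (by rwa [c12]), c12]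
        have d20 : τ₃.reg 20 = τ₂.reg 20 := by
          rw [hτ₃, Stmt.eval_reg_of_notMem _ _ (by decide)]
        have d21 : τ₃.reg 21 = τ₂.reg 21 := by
          rw [hτ₃, Stmt.eval_reg_of_notMem _ _ (by decide)]
        have d12 : τ₃.reg 12 = k := by
          rw [hτ₃, Stmt.eval_reg_of_notMem _ _ (by decide), c12]
        clear_value τ₃
        have hm := ht₃.input k (by omega)
        by_cases hkU : k ∈ U
        · simp [Stmt.eval, ht₃.zero, d18, hkU, d12, d20, d21, c20, c21, hτ20, hτ21, b17, hm]
        · simp [Stmt.eval, ht₃.zero, d18, hkU, d20, d21, c20, c21, hτ20, hτ21, b17])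
  rw [h₁.n] at this
  generalize Stmt.eval _ σ₁ = τ at this ⊢
  obtain ⟨hτ, hτ22, hτ20, hτ21⟩ := this
  have hnb : range I.n ∩ nbhd I.n I.Near U = nbhd I.n I.Near U :=
    inter_eq_right.2 fun z hz => mem_range.2 (mem_nbhd.1 hz).1
  rw [sum_boole, filter_mem_eq_inter, hnb, Nat.cast_id] at hτ20
  rw [← sum_filter, filter_mem_eq_inter, inter_eq_right.2 hU] at hτ21
  simp only [Stmt.eval, hτ.t, hτ.w, hτ20, hτ21]
  by_cases hA : I.Accepts U
  · rw [if_pos hA, if_neg hA.1.not_gt, if_neg hA.2.not_gt]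
    simp
  · rw [if_neg hA, ← hτ22]
    split_ifs with h1 h2
    · rfl
    · rfl
    · exact absurd ⟨not_lt.1 h1, not_lt.1 h2⟩ hA

lemma eval_tryCandidate (h : Represents I U σ) (hv : σ.reg 7 < I.n)
    (he : σ.reg 8 < 2 ^ (2 * I.t)) :
    Represents I (candidate I.n I.Near (σ.reg 7) (σ.reg 8)) (Stmt.tryCandidate.eval σ) ∧
      (I.Accepts (candidate I.n I.Near (σ.reg 7) (σ.reg 8)) →
        (Stmt.tryCandidate.eval σ).reg 22 = 1) ∧
      (¬ I.Accepts (candidate I.n I.Near (σ.reg 7) (σ.reg 8)) →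
        (Stmt.tryCandidate.eval σ).reg 22 = σ.reg 22) := by
  classical
  -- All later steps preserve this invariant.
  let Inv : Finset ℕ × ℕ → Store → Prop := fun s τ =>
    Represents I s.1 τ ∧ τ.reg 9 = s.2 ∧ s.2 ≤ 2 ^ (2 * I.t) ∧ τ.reg 22 = σ.reg 22
  have hset : ∀ s τ d x, 7 ≤ d → d ≠ 9 → d ≠ 22 → Inv s τ → Inv s (τ.set d x) := by
    rintro s τ d x hd h9 h22 ⟨h1, h2, h3, h4⟩
    exact ⟨h1.update _ hd, by simp [h2, h9.symm], h3, by simp [h4, h22.symm]⟩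
  simp only [Stmt.tryCandidate, Stmt.eval_block_cons, Stmt.eval_block_nil]
  set W : Finset ℕ := {u ∈ range I.n | I.Near (σ.reg 7) u} with hW
  set σ₁ := Stmt.initSet.eval ((Stmt.add 9 8 4).eval σ) with hσ₁
  have i₁ : Inv (W, σ.reg 8) σ₁ := by
    have h0 := h.eval (.add 9 8 4) rfl (by decide)
    have h7 : ((Stmt.add 9 8 4).eval σ).reg 7 = σ.reg 7 :=
      Stmt.eval_reg_of_notMem _ _ (by decide)
    refine ⟨by simpa only [h7] using h0.eval_initSet (by rwa [h7]), ?_, he.le, ?_⟩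
    · rw [hσ₁, Stmt.eval_reg_of_notMem _ _ (by decide)]; simp [Stmt.eval, h.zero]
    · rw [hσ₁, Stmt.eval_reg_of_notMem _ _ (by decide),
        Stmt.eval_reg_of_notMem _ _ (by decide)]
  clear_value σ₁
  have i₂ := Stmt.eval_loop_induction (i := 10) (b := 0) (σ := σ₁)
    (S := Stmt.loop 11 0 Stmt.splitPair)
    (fun k τ => Inv (forRange (fun x s => forRange (splitPair I.Near x) s I.n) (W, σ.reg 8) k) τ)
    (hset _ _ _ _ (by norm_num) (by norm_num) (by norm_num) i₁)
    (by
      rintro k hk τ hτk hτ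
      rw [i₁.1.n] at hk
      refine hset _ _ _ _ (by norm_num) (by norm_num) (by norm_num) ?_
      have := Stmt.eval_loop_induction (i := 11) (b := 0) (σ := τ) (S := Stmt.splitPair)
        (fun l τ' => τ'.reg 10 = k ∧ Inv (forRange (splitPair I.Near k)
          (forRange (fun x s => forRange (splitPair I.Near x) s I.n) (W, σ.reg 8) k) l) τ')
        ⟨by simp [hτk], hset _ _ _ _ (by norm_num) (by norm_num) (by norm_num) hτ⟩
        (by
          rintro l hl τ' hl' ⟨h10, h1, h2, h3, h4⟩
          rw [hτ.1.n] at hl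
          refine ⟨?_, hset _ _ _ _ (by norm_num) (by norm_num) (by norm_num) ?_⟩
          · rw [Store.set_reg, if_neg (by norm_num), Stmt.eval_reg_of_notMem _ _ (by decide), h10]
          · have := h1.eval_splitPair h2 h3 (by rwa [h10]) (by rwa [hl'])
            rw [h10, hl'] at this
            refine ⟨this.1, this.2.1, this.2.2, ?_⟩
            rw [Stmt.eval_reg_of_notMem _ _ (by decide), h4])
      rw [hτ.1.n] at this
      exact this.2)
  rw [i₁.1.n] at i₂
  change Inv (cliquePass I.n I.Near (W, σ.reg 8)) _ at i₂
  generalize Stmt.eval _ σ₁ = σ₂ at i₂ ⊢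
  have hsub : (cliquePass I.n I.Near (W, σ.reg 8)).1 ⊆ range I.n :=
    (cliquePass_spec _ _ _).1.trans (filter_subset _ _)
  have i₃ := Stmt.eval_loop_induction (i := 12) (b := 0) (σ := σ₂) (S := Stmt.detach)
    (fun k τ => Inv (forRange (detach I.n I.Near) (cliquePass I.n I.Near (W, σ.reg 8)) k) τ)
    (hset _ _ _ _ (by norm_num) (by norm_num) (by norm_num) i₂)
    (by
      rintro k hk τ hτk ⟨h1, h2, h3, h4⟩
      rw [i₂.1.n] at hk
      refine hset _ _ _ _ (by norm_num) (by norm_num) (by norm_num) ?_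
      have hs := (forRange_shrinks (Q := fun _ _ => True) (by simp)
        (fun z s => ⟨detach_subset I.n I.Near z s, trivial⟩)
        (cliquePass I.n I.Near (W, σ.reg 8)) k).1.trans hsub
      have := h1.eval_detach h2 h3 (by rwa [hτk]) hs
      rw [hτk] at this
      refine ⟨this.1, this.2.1, this.2.2, ?_⟩
      rw [Stmt.eval_reg_of_notMem _ _ (by decide), h4])
  rw [i₂.1.n] at i₃
  change Inv (detachPass I.n I.Near (cliquePass I.n I.Near (W, σ.reg 8))) _ at i₃
  generalize Stmt.eval _ σ₂ = σ₃ at i₃ ⊢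
  have hcheck := i₃.1.eval_check ((detachPass_subset _ _ _).trans hsub)
  rw [i₃.2.2.2] at hcheck
  exact ⟨i₃.1.eval _ rfl (by decide), fun hA => hcheck.trans (if_pos hA),
    fun hA => hcheck.trans (if_neg hA)⟩

open Classical in
/-- The search reports whether some candidate is accepted. -/
lemma eval_search (h : Represents I U σ) (h0 : σ.reg 22 = 0) :
    (Stmt.search.eval σ).reg 4 = 0 ∧ (Stmt.search.eval σ).reg 22 =
      if ∃ v < I.n, ∃ e < 2 ^ (2 * I.t), I.Accepts (candidate I.n I.Near v e) then 1 else 0 := by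
  have := Stmt.eval_loop_induction (i := 7) (b := 0) (σ := σ) (S := Stmt.loop 8 5 Stmt.tryCandidate)
    (fun k τ => (∃ U, Represents I U τ) ∧ τ.reg 22 =
      if ∃ v < k, ∃ e < 2 ^ (2 * I.t), I.Accepts (candidate I.n I.Near v e) then 1 else 0)
    ⟨⟨U, h.update _ (by norm_num)⟩, by simp [h0]⟩
    (by
      rintro k hk τ hτk ⟨⟨U₁, hτ⟩, h22⟩
      rw [h.n] at hk
      have := Stmt.eval_loop_induction (i := 8) (b := 5) (σ := τ) (S := Stmt.tryCandidate)
        (fun l τ' => (∃ U, Represents I U τ') ∧ τ'.reg 7 = k ∧ τ'.reg 22 =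
          if (∃ v < k, ∃ e < 2 ^ (2 * I.t), I.Accepts (candidate I.n I.Near v e)) ∨
            ∃ e < l, I.Accepts (candidate I.n I.Near k e) then 1 else 0)
        ⟨⟨U₁, hτ.update _ (by norm_num)⟩, by simp [hτk], by simp [h22]⟩
        (by
          rintro l hl τ' hl' ⟨⟨U₂, hτ'⟩, h7, h22'⟩
          rw [hτ.guesses] at hl
          obtain ⟨h1, h2, h3⟩ := hτ'.eval_tryCandidate (by rwa [h7]) (by rwa [hl'])
          refine ⟨⟨_, h1.update _ (by norm_num)⟩, ?_, ?_⟩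
          · rw [Store.set_reg, if_neg (by norm_num), Stmt.eval_reg_of_notMem _ _ (by decide), h7]
          · rw [Store.set_reg, if_neg (by norm_num)]
            rw [h7, hl'] at h2 h3
            have hsucc : (∃ e < l + 1, I.Accepts (candidate I.n I.Near k e)) ↔
                (∃ e < l, I.Accepts (candidate I.n I.Near k e)) ∨
                  I.Accepts (candidate I.n I.Near k l) := by
              simp only [Nat.lt_succ_iff_lt_or_eq, or_and_right, exists_or, exists_eq_left]
            by_cases hA : I.Accepts (candidate I.n I.Near k l)
            · rw [h2 hA, if_pos (.inr (hsucc.2 (.inr hA)))]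
            · rw [h3 hA, h22']
              simp only [hsucc, hA, or_false])
      rw [hτ.guesses] at this
      obtain ⟨⟨U₂, h1⟩, -, h2⟩ := this
      refine ⟨⟨U₂, h1.update _ (by norm_num)⟩, ?_⟩
      rw [Store.set_reg, if_neg (by norm_num), h2]
      simp only [Nat.lt_succ_iff_lt_or_eq, or_and_right, exists_or, exists_eq_left])
  rw [h.n] at this
  obtain ⟨⟨U', h1⟩, h2⟩ := this
  exact ⟨h1.zero, h2⟩

end Represents

end SecludedClique

/-! ### Yes-instances and the running time -/

namespace SecludedClique

open RAM Finset

/-- Reflexive pairs do not matter for `nbhd`, which excludes the members of the set. -/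
lemma coe_nbhd_map (I : Input) (U : Finset (Fin I.n)) :
    (nbhd I.n I.Near (U.map Fin.valEmbedding) : Set ℕ) =
      Fin.val '' I.G.openNeighborhood (U : Set (Fin I.n)) := by
  ext z
  simp only [SetLike.mem_coe, mem_nbhd, mem_map, Fin.valEmbedding_apply, Set.mem_image,
    SimpleGraph.openNeighborhood, Set.mem_ofPred_eq]
  constructor
  · rintro ⟨hz, hzU, u, ⟨u, hu, rfl⟩, huz⟩
    have hzU' : (⟨z, hz⟩ : Fin I.n) ∉ U := fun h => hzU ⟨_, h, rfl⟩
    rcases huz with rfl | ⟨_, _, h⟩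
    · exact absurd hu hzU'
    · exact ⟨⟨z, hz⟩, ⟨hzU', u, hu, h.symm⟩, rfl⟩
  · rintro ⟨z, ⟨hzU, u, hu, h⟩, rfl⟩
    refine ⟨z.2, ?_, u, ⟨u, hu, rfl⟩, .inr ⟨z.2, u.2, h.symm⟩⟩
    rintro ⟨z', hz', h'⟩
    exact hzU (Fin.ext h' ▸ hz')

lemma isSecluded_iff (I : Input) (U : Finset (Fin I.n)) :
    I.G.IsSecluded I.t (U : Set (Fin I.n)) ↔
      #(nbhd I.n I.Near (U.map Fin.valEmbedding)) ≤ I.t := by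
  rw [SimpleGraph.IsSecluded, ← Fin.val_injective.encard_image, ← coe_nbhd_map,
    Set.encard_coe_eq_coe_finsetCard, Nat.cast_le]

lemma sum_map_init_mem (I : Input) (U : Finset (Fin I.n)) :
    ∑ u ∈ U.map Fin.valEmbedding, I.init.mem u = ∑ v ∈ U, I.weight v := by
  rw [sum_map]
  refine sum_congr rfl fun v _ => ?_
  simp [Input.init]

/-- A solution lies in a candidate with few neighbours, whose weight can only be larger. Conversely,
every candidate is a clique. -/
theorem isYes_iff (I : Input) :
    I.IsYes ↔ ∃ v < I.n, ∃ e < 2 ^ (2 * I.t), I.Accepts (candidate I.n I.Near v e) := by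
  classical
  constructor
  · rintro ⟨U, hclique, hsec, hw⟩
    set S := U.map Fin.valEmbedding with hS
    have hSn : S ⊆ range I.n := fun z hz => by
      obtain ⟨u, -, rfl⟩ := mem_map.1 hz
      exact mem_range.2 u.2
    have hcl : ∀ x ∈ S, ∀ y ∈ S, I.Near x y := by
      intro x hxS y hyS
      obtain ⟨x, hx, rfl⟩ := mem_map.1 hxS
      obtain ⟨y, hy, rfl⟩ := mem_map.1 hyS
      by_cases hxy : x = y
      · exact .inl (by rw [hxy])
      · exact .inr ⟨x.2, y.2, hclique hx hy hxy⟩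
    have hne : S.Nonempty := by
      rw [hS, map_nonempty, nonempty_iff_ne_empty]
      rintro rfl
      have := I.w_pos
      simp at hw
      omega
    obtain ⟨v, hv, e, he, hsub, ht⟩ := exists_candidate (fun _ _ h => h.symm) hSn hcl hne
      ((isSecluded_iff I U).1 hsec)
    refine ⟨v, hv, e, he, ht, hw.trans ?_⟩
    rw [← sum_map_init_mem]
    exact sum_le_sum_of_subset hsub
  · rintro ⟨v, -, e, -, ht, hw⟩
    set c := candidate I.n I.Near v e with hc
    have hcn : c ⊆ range I.n := candidate_subset _ _ _ _
    have hmap : (univ.filter fun u : Fin I.n => u.val ∈ c).map Fin.valEmbedding = c := by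
      ext z
      simp only [mem_map, mem_filter, mem_univ, true_and, Fin.valEmbedding_apply]
      exact ⟨fun ⟨u, hu, h⟩ => h ▸ hu, fun hz => ⟨⟨z, mem_range.1 (hcn hz)⟩, hz, rfl⟩⟩
    refine ⟨univ.filter fun u : Fin I.n => u.val ∈ c, ?_, ?_, ?_⟩
    · have key : ∀ x y : Fin I.n, x < y → x.val ∈ c → y.val ∈ c → I.G.Adj x y := by
        intro x y hxy hx hy
        rcases candidate_clique hxy hx hy with h | ⟨_, _, h⟩
        · exact absurd (Fin.ext h) hxy.ne
        · exact h
      intro x hx y hy hxy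
      simp only [coe_filter, mem_univ, true_and, Set.mem_ofPred_eq] at hx hy
      rcases lt_or_gt_of_ne hxy with h | h
      · exact key x y h hx hy
      · exact (key y x h hy hx).symm
    · rw [isSecluded_iff, hmap]
      exact ht
    · rw [← sum_map_init_mem, hmap]
      exact hw

/-- The store on the input `I` after the first instruction. -/
noncomputable def Input.store (I : Input) : Store := Store.set ⟨I.init.reg, I.init.mem⟩ 3 1

lemma Input.init_mem_above (I : Input) (u : ℕ) : I.init.mem (I.n + I.n * I.n + u) = 0 := by
  simp only [Input.init]
  rw [dif_neg (by omega), if_neg]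
  rintro ⟨x, y, h, -⟩
  have := Nat.mul_le_mul_right I.n (Nat.succ_le_of_lt x.2)
  rw [Nat.succ_mul] at this
  have := y.2
  omega

lemma represents_setup (I : Input) : Represents I ∅ (Stmt.setup.eval I.store) := by
  have r : ∀ i, i ∉ Stmt.setup.writes → (Stmt.setup.eval I.store).reg i = I.store.reg i :=
    fun i hi => Stmt.eval_reg_of_notMem _ _ hi
  have hm : (Stmt.setup.eval I.store).mem = I.init.mem :=
    (Stmt.eval_mem_of_storeFree _ _ rfl).trans rfl
  have h56 : (Stmt.setup.eval I.store).reg 5 = 2 ^ (2 * I.t) ∧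
      (Stmt.setup.eval I.store).reg 6 = I.n + I.n * I.n := by
    simp only [Stmt.setup, Stmt.eval_block_cons, Stmt.eval_block_nil]
    set σ₁ := (Stmt.const 5 1).eval I.store with hσ₁
    have h1 : σ₁.reg 1 = I.t := by simp [hσ₁, Stmt.eval, Input.store, Input.init]
    have l₁ := Stmt.eval_loop_induction (i := 14) (b := 1) (σ := σ₁)
      (S := Stmt.block [.add 5 5 5, .add 5 5 5])
      (fun k τ => τ.reg 5 = 2 ^ (2 * k) ∧ τ.reg 0 = I.n ∧ τ.reg 4 = 0)
      (by simp [hσ₁, Stmt.eval, Input.store, Input.init])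
      (by
        rintro k - τ - ⟨h5, h0, h4⟩
        simp [Stmt.eval, h5, h0, h4]
        ring)
    rw [h1] at l₁
    generalize Stmt.eval _ σ₁ = σ₂ at l₁ ⊢
    obtain ⟨h5, h0, h4⟩ := l₁
    set σ₃ := (Stmt.add 6 0 4).eval σ₂ with hσ₃
    have h0' : σ₃.reg 0 = I.n := by simp [hσ₃, Stmt.eval, h0]
    have l₂ := Stmt.eval_loop_induction (i := 14) (b := 0) (σ := σ₃) (S := .add 6 6 0)
      (fun k τ => τ.reg 5 = 2 ^ (2 * I.t) ∧ τ.reg 6 = I.n + k * I.n ∧ τ.reg 0 = I.n)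
      (by simp [hσ₃, Stmt.eval, h5, h0, h4])
      (by
        rintro k - τ - ⟨h5, h6, h0⟩
        simp [Stmt.eval, h5, h6, h0]
        ring)
    rw [h0'] at l₂
    exact ⟨l₂.1, l₂.2.1⟩
  constructor
  · rw [r 0 (by decide)]; simp [Input.store, Input.init]
  · rw [r 1 (by decide)]; simp [Input.store, Input.init]
  · rw [r 2 (by decide)]; simp [Input.store, Input.init]
  · rw [r 3 (by decide)]; simp [Input.store]
  · rw [r 4 (by decide)]; simp [Input.store, Input.init]
  · exact h56.1
  · exact h56.2
  · intro a _; rw [hm]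
  · intro u _; rw [hm, I.init_mem_above]; simp

/-- The machine program: after the search, the answer is moved to register `0`. -/
def program : Program :=
  .const 3 1 :: (Stmt.setup.compile 1 ++
    (Stmt.search.compile (1 + Stmt.setup.size) ++ [.add 0 22 4]))

/-- The program solves the problem, in time bounded in terms of any bound on `n` and `4 ^ t`. -/
theorem exists_halting_run (I : Input) {M : ℕ} (hn : I.n ≤ M) (ht : 2 ^ (2 * I.t) ≤ M) :
    ∃ k ≤ (Stmt.seq Stmt.setup Stmt.search).time M + 2, Halted program ((step program)^[k] I.init) ∧
      (I.IsYes → ((step program)^[k] I.init).reg 0 = 1) ∧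
      (¬ I.IsYes → ((step program)^[k] I.init).reg 0 = 0) := by
  have hcode : Stmt.CodeAt program 0 program := fun i hi => by simp [hi]
  have htM : I.t ≤ M := by
    have := Nat.lt_two_pow_self (n := 2 * I.t)
    omega
  have h1 : Stmt.RunsTo program I.init (I.store.at 1) 1 :=
    Stmt.RunsTo.single (σ := ⟨I.init.reg, I.init.mem⟩) (p := 0) hcode.head
  have h2 := Stmt.runsTo_compile (M := M) Stmt.setup 1 I.store hcode.tail.left rfl (by decide)
    (by
      intro r hr
      have : r = 1 ∨ r = 0 := by simpa [Stmt.setup, Stmt.block, Stmt.bounds] using hr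
      rcases this with rfl | rfl <;> simpa [Input.store, Input.init])
    (by decide) (by simp [Input.store])
  have hrep := represents_setup I
  have h22 : (Stmt.setup.eval I.store).reg 22 = 0 := by
    rw [Stmt.eval_reg_of_notMem _ _ (by decide)]; simp [Input.store, Input.init]
  have hright := hcode.tail.right
  rw [Stmt.length_compile] at hright
  have hbounds : ∀ r ∈ Stmt.search.bounds, r = 0 ∨ r = 5 := by decide
  have h3 := Stmt.runsTo_compile (M := M) Stmt.search (1 + Stmt.setup.size)
    (Stmt.setup.eval I.store) hright.left rfl (by decide)
    (by
      intro r hr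
      rcases hbounds r hr with rfl | rfl
      · rwa [hrep.n]
      · rwa [hrep.guesses])
    (by decide) hrep.one
  have hlast := hright.right
  rw [Stmt.length_compile] at hlast
  have h4 := Stmt.RunsTo.single (σ := Stmt.search.eval (Stmt.setup.eval I.store)) hlast.head
  obtain ⟨k, hk, hrun⟩ := ((h1.trans h2).trans h3).trans h4
  refine ⟨k, by simp only [Stmt.time]; omega, ?_⟩
  rw [hrun]
  obtain ⟨hz, hans⟩ := hrep.eval_search h22
  simp only [isYes_iff]
  refine ⟨?_, fun h => ?_, fun h => ?_⟩
  · simp only [Halted, program, exec, Store.at, List.length_cons, List.length_append,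
      Stmt.length_compile, List.length_nil]
    omega
  · simp [exec, Store.at, hz, hans, if_pos h]
  · simp [exec, Store.at, hz, hans, if_neg h]

/-- The factor `4` is needed only for `t = 1`, where `t * logb 2 t` vanishes. -/
lemma four_pow_le (t : ℕ) :
    (4 : ℝ) ^ t ≤ 4 * (2 : ℝ) ^ (2 * ((t : ℝ) * Real.logb 2 (t : ℝ))) := by
  rcases Nat.lt_or_ge t 2 with h | h
  · interval_cases t <;> norm_num
  · have h1 : (1 : ℝ) ≤ Real.logb 2 t := by
      rw [Real.le_logb_iff_rpow_le (by norm_num) (by positivity)]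
      simpa using (by exact_mod_cast h : (2 : ℝ) ≤ t)
    have h2 : (4 : ℝ) ^ t = (2 : ℝ) ^ (2 * (t : ℝ)) := by
      rw [Real.rpow_mul (by norm_num), Real.rpow_natCast]; norm_num
    have h3 : (2 : ℝ) ^ (2 * (t : ℝ)) ≤ (2 : ℝ) ^ (2 * ((t : ℝ) * Real.logb 2 (t : ℝ))) := by
      apply Real.rpow_le_rpow_of_exponent_le (by norm_num)
      have : (t : ℝ) * 1 ≤ t * Real.logb 2 t := by gcongr
      linarith
    have h4 : (0 : ℝ) ≤ (2 : ℝ) ^ (2 * ((t : ℝ) * Real.logb 2 (t : ℝ))) := by positivity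
    linarith

end SecludedClique

theorem mainTheorem4 :
    ∃ (P : RAM.Program) (a b C : ℕ), ∀ I : SecludedClique.Input,
      RAM.DecidesWithin P I.init I.IsYes
        ((C : ℝ) * (2 : ℝ) ^ ((a : ℝ) * ((I.t : ℝ) * Real.logb 2 (I.t : ℝ)))
          * ((I.n : ℝ) + 1) ^ b) := by
  obtain ⟨c, d, hcd⟩ := RAM.Stmt.exists_time_le (.seq RAM.Stmt.setup RAM.Stmt.search)
  refine ⟨SecludedClique.program, 2 * d, d, (c + 2) * 8 ^ d, fun I => ?_⟩
  obtain ⟨k, hk, hrun⟩ := SecludedClique.exists_halting_run I (M := I.n + 2 ^ (2 * I.t))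
    (Nat.le_add_right _ _) (Nat.le_add_left _ _)
  refine ⟨k, ?_, hrun⟩
  -- Every loop bound is at most `n + 4 ^ t`, which is at most `2 * 4 ^ t * (n + 1)` even after
  -- adding one.
  have hM : I.n + 2 ^ (2 * I.t) + 1 ≤ 2 * 4 ^ I.t * (I.n + 1) := by
    have : 1 ≤ 4 ^ I.t := Nat.one_le_pow _ _ (by norm_num)
    rw [pow_mul]
    norm_num
    nlinarith
  have hk' : k ≤ (c + 2) * (2 * 4 ^ I.t * (I.n + 1)) ^ d := by
    have h1 := Nat.pow_le_pow_left hM d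
    have h2 : 1 ≤ (I.n + 2 ^ (2 * I.t) + 1) ^ d := Nat.one_le_pow _ _ (Nat.succ_pos _)
    have h3 := hcd (I.n + 2 ^ (2 * I.t))
    refine le_trans ?_ (Nat.mul_le_mul_left (c + 2) h1)
    rw [add_mul c 2]
    linarith
  have hexp : (2 : ℝ) ^ (((2 * d : ℕ) : ℝ) * ((I.t : ℝ) * Real.logb 2 (I.t : ℝ))) =
      ((2 : ℝ) ^ (2 * ((I.t : ℝ) * Real.logb 2 (I.t : ℝ)))) ^ d := by
    rw [← Real.rpow_natCast, ← Real.rpow_mul (by norm_num)]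
    congr 1
    push_cast
    ring
  rw [hexp]
  calc (k : ℝ) ≤ (c + 2) * (2 * 4 ^ I.t * (I.n + 1)) ^ d := by exact_mod_cast hk'
    _ ≤ (c + 2) * (2 * (4 * (2 : ℝ) ^ (2 * ((I.t : ℝ) * Real.logb 2 (I.t : ℝ)))) *
          (I.n + 1)) ^ d := by
        gcongr
        exact SecludedClique.four_pow_le I.t
    _ = _ := by
        push_cast
        rw [show (8 : ℝ) = 2 * 4 by norm_num]
        simp only [mul_pow]
        ring
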